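/- Let $\mathcal X,\mathcal Y,\mathcal Z$ be finite sets and let $W(z\mid x,y)$ be a discrete memoryless two-user multiple access channel with input alphabets $\mathcal X$ (user A) and $\mathcal Y$ (user B) and output alphabet $\mathcal Z$. Write $W^n(S\mid \mathbf x,\mathbf y)=\sum_{\mathbf z\in S}\prod_{t=1}^n W(z_t\mid x_t,y_t)$ for $S\subseteq\mathcal Z^n$. An $(N_A,N_B,n)$ adversary identifying code consists of encoders $f_A:\{1,\dots,N_A\}\to\mathcal X^n$, $f_B:\{1,\dots,N_B\}\to\mathcal Y^n$ and a decoder $\phi:\mathcal Z^n\to(\{1,\dots,N_A\}\times\{1,\dots,N_B\})\cup\{\mathbf a,\mathbf b\}$, where the output $\mathbf a$ (resp. $\mathbf b$) declares user A (resp. B) adversarial. Its error probability is $P_e=\max\{P_{\mathrm{hon}},P_{\mathrm{mal}A},P_{\mathrm{mal}B}\}$ with $$P_{\mathrm{hon}}=\frac1{N_AN_B}\sum_{m_A,m_B}W^n\big(\{\mathbf z:\phi(\mathbf z)\ne(m_A,m_B)\}\mid f_A(m_A),f_B(m_B)\big),$$ $$P_{\mathrm{mal}A}=\max_{\mathbf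 x\in\mathcal X^n}\frac1{N_B}\sum_{m_B}W^n\big(\mathcal E^B_{m_B}\mid \mathbf x,f_B(m_B)\big),\qquad P_{\mathrm{mal}B}=\max_{\mathbf y\in\mathcal Y^n}\frac1{N_A}\sum_{m_A}W^n\big(\mathcal E^A_{m_A}\mid f_A(m_A),\mathbf y\big),$$ where $\mathcal E^B_{m_B}$ is the set of $\mathbf z$ such that $\phi(\mathbf z)$ is neither $\mathbf a$ nor a message pair whose second component is $m_B$, and $\mathcal E^A_{m_A}$ is the set of $\mathbf z$ such that $\phi(\mathbf z)$ is neither $\mathbf b$ nor a message pair whose first component is $m_A$. A pair $(R_A,R_B)\in[0,\infty)^2$ is achievable if there is a sequence, $n=1,2,\dots$, of $(\lfloor 2^{nR_A}\rfloor,\lfloor 2^{nR_B}\rfloor,n)$ adversary identifying codes with $P_e\to0$ as $n\to\infty$. The capacity region of communication with adversary identification, $\mathcal C\subseteq\mathbb R^2$, is the closure of the set of achievable pairs. The channel is A-spoofable if there are conditional distributions $Q_{Y|\tilde X\tilde Y}$ and $Q_{X|\tilde XX'}$ such that for all $x',\tilde x\in\mathcal X$, $\tilde y\in\mathcal Y$,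 $z\in\mathcal Z$, $$\sum_yQ_{Y|\tilde X\tilde Y}(y|\tilde x,\tilde y)W(z|x',y)=\sum_yQ_{Y|\tilde X\tilde Y}(y|x',\tilde y)W(z|\tilde x,y)=\sum_xQ_{X|\tilde XX'}(x|\tilde x,x')W(z|x,\tilde y).$$ It is B-spoofable if there are conditional distributions $Q_{X|\tilde X\tilde Y}$ and $Q_{Y|\tilde YY'}$ such that for all $\tilde x\in\mathcal X$, $\tilde y,y'\in\mathcal Y$, $z\in\mathcal Z$, $$\sum_xQ_{X|\tilde X\tilde Y}(x|\tilde x,\tilde y)W(z|x,y')=\sum_xQ_{X|\tilde X\tilde Y}(x|\tilde x,y')W(z|x,\tilde y)=\sum_yQ_{Y|\tilde YY'}(y|\tilde y,y')W(z|\tilde x,y).$$ It is spoofable if it is A-spoofable or B-spoofable. Then $\mathcal C$ has empty interior in $\mathbb R^2$ if and only if the channel is spoofable. -/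

import Mathlib

/-! Two-user byzantine multiple access channels and communication with adversary identification.
User A has input alphabet `𝒳`, user B has input alphabet `𝒴`, the output alphabet is `𝒵`.
Probability distributions on a finite set `α` are the points of `stdSimplex ℝ α`. -/

namespace ByzantineMAC

/-- A discrete memoryless two-user multiple access channel: `W x y z` is the probability of the
output `z` when user A inputs `x` and user B inputs `y`. -/
abbrev Channel (𝒳 𝒴 𝒵 : Type*) [Fintype 𝒵] := 𝒳 → 𝒴 → stdSimplex ℝ 𝒵

section Spoofable

variable {𝒳 𝒴 𝒵 : Type*} [Fintype 𝒳] [Fintype 𝒴] [Fintype 𝒵]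

/-- The channel is A-spoofable. Here `QY xt yt y` is the conditional probability of `y` given
`(xt, yt)`, and `QX xt x' x` is the conditional probability of `x` given `(xt, x')`. -/
def IsASpoofable (W : Channel 𝒳 𝒴 𝒵) : Prop :=
  ∃ (QY : 𝒳 → 𝒴 → stdSimplex ℝ 𝒴) (QX : 𝒳 → 𝒳 → stdSimplex ℝ 𝒳),
    ∀ (x' xt : 𝒳) (yt : 𝒴) (z : 𝒵),
      ∑ y, QY xt yt y * W x' y z = ∑ y, QY x' yt y * W xt y z ∧
      ∑ y, QY x' yt y * W xt y z = ∑ x, QX xt x' x * W x yt z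

/-- The channel is B-spoofable. Here `QX xt yt x` is the conditional probability of `x` given
`(xt, yt)`, and `QY yt y' y` is the conditional probability of `y` given `(yt, y')`. -/
def IsBSpoofable (W : Channel 𝒳 𝒴 𝒵) : Prop :=
  ∃ (QX : 𝒳 → 𝒴 → stdSimplex ℝ 𝒳) (QY : 𝒴 → 𝒴 → stdSimplex ℝ 𝒴),
    ∀ (xt : 𝒳) (yt y' : 𝒴) (z : 𝒵),
      ∑ x, QX xt yt x * W x y' z = ∑ x, QX xt y' x * W x yt z ∧
      ∑ x, QX xt y' x * W x yt z = ∑ y, QY yt y' y * W xt y z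

/-- A channel is spoofable if it is A-spoofable or B-spoofable. -/
def IsSpoofable (W : Channel 𝒳 𝒴 𝒵) : Prop :=
  IsASpoofable W ∨ IsBSpoofable W

end Spoofable

/-- The possible outputs of the decoder: a pair of messages, or the declaration that user A
(respectively user B) is adversarial. -/
inductive DecoderOutput (NA NB : ℕ) : Type
  | messages (mA : Fin NA) (mB : Fin NB)
  | blameA
  | blameB

/-- The possible values of the part of the decoder output that concerns a single user. -/
inductive UserOutput (N : ℕ) : Type
  | message (m : Fin N)
  | blameA
  | blameB

/-- The decoder output for the message of user A. -/
def DecoderOutput.forA {NA NB : ℕ} : DecoderOutput NA NB → UserOutput NA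
  | .messages mA _ => .message mA
  | .blameA => .blameA
  | .blameB => .blameB

/-- The decoder output for the message of user B. -/
def DecoderOutput.forB {NA NB : ℕ} : DecoderOutput NA NB → UserOutput NB
  | .messages _ mB => .message mB
  | .blameA => .blameA
  | .blameB => .blameB

/-- An `(NA, NB, n)` deterministic adversary identifying code. -/
structure Code (𝒳 𝒴 𝒵 : Type*) (NA NB n : ℕ) where
  /-- encoder of user A -/
  encA : Fin NA → (Fin n → 𝒳)
  /-- encoder of user B -/
  encB : Fin NB → (Fin n → 𝒴)
  /-- decoder -/
  dec : (Fin n → 𝒵) → DecoderOutput NA NB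

section Coding

variable {𝒳 𝒴 𝒵 : Type*} [Fintype 𝒵]

open Classical in
/-- `W^n(S | x, y)`: the probability under the `n`-fold product channel that the output sequence
lies in `S` when the input sequences are `x` and `y`. -/
noncomputable def Channel.prodProb (W : Channel 𝒳 𝒴 𝒵) {n : ℕ} (S : Set (Fin n → 𝒵))
    (x : Fin n → 𝒳) (y : Fin n → 𝒴) : ℝ :=
  ∑ z : Fin n → 𝒵 with z ∈ S, ∏ t, W (x t) (y t) (z t)

variable {NA NB n : ℕ}

/-- Error event when both users are honest and send `mA` and `mB`. -/
def Code.errHon (c : Code 𝒳 𝒴 𝒵 NA NB n) (mA : Fin NA) (mB : Fin NB) : Set (Fin n → 𝒵) :=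
  {z | c.dec z ≠ .messages mA mB}

/-- Error event for the message `mA` of an honest user A when user B is adversarial. -/
def Code.errA (c : Code 𝒳 𝒴 𝒵 NA NB n) (mA : Fin NA) : Set (Fin n → 𝒵) :=
  {z | (c.dec z).forA ≠ .message mA ∧ (c.dec z).forA ≠ .blameB}

/-- Error event for the message `mB` of an honest user B when user A is adversarial. -/
def Code.errB (c : Code 𝒳 𝒴 𝒵 NA NB n) (mB : Fin NB) : Set (Fin n → 𝒵) :=
  {z | (c.dec z).forB ≠ .message mB ∧ (c.dec z).forB ≠ .blameA}

/-- Average probability of error when both users are honest. -/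
noncomputable def Code.peHon (c : Code 𝒳 𝒴 𝒵 NA NB n) (W : Channel 𝒳 𝒴 𝒵) : ℝ :=
  (1 / ((NA : ℝ) * NB)) *
    ∑ mA : Fin NA, ∑ mB : Fin NB, W.prodProb (c.errHon mA mB) (c.encA mA) (c.encB mB)

/-- Average probability of error when user A is adversarial (a maximum over the finitely many
input sequences of user A). -/
noncomputable def Code.peMalA (c : Code 𝒳 𝒴 𝒵 NA NB n) (W : Channel 𝒳 𝒴 𝒵) : ℝ :=
  ⨆ x : Fin n → 𝒳, (1 / (NB : ℝ)) * ∑ mB : Fin NB, W.prodProb (c.errB mB) x (c.encB mB)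

/-- Average probability of error when user B is adversarial (a maximum over the finitely many
input sequences of user B). -/
noncomputable def Code.peMalB (c : Code 𝒳 𝒴 𝒵 NA NB n) (W : Channel 𝒳 𝒴 𝒵) : ℝ :=
  ⨆ y : Fin n → 𝒴, (1 / (NA : ℝ)) * ∑ mA : Fin NA, W.prodProb (c.errA mA) (c.encA mA) y

/-- The average probability of error of a code. -/
noncomputable def Code.pe (c : Code 𝒳 𝒴 𝒵 NA NB n) (W : Channel 𝒳 𝒴 𝒵) : ℝ :=
  max (c.peHon W) (max (c.peMalA W) (c.peMalB W))

/-- `R = (R_A, R_B)` is an achievable rate pair for communication with adversary identification.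
Rates are nonnegative. The blocklengths are `n = 1, 2, …`; the term `n = 0` of the sequence is
immaterial, since a `(1, 1, 0)` code always exists. -/
def IsAchievable (W : Channel 𝒳 𝒴 𝒵) (R : ℝ × ℝ) : Prop :=
  0 ≤ R.1 ∧ 0 ≤ R.2 ∧
    ∃ c : ∀ n : ℕ,
        Code 𝒳 𝒴 𝒵 ⌊(2 : ℝ) ^ ((n : ℝ) * R.1)⌋₊ ⌊(2 : ℝ) ^ ((n : ℝ) * R.2)⌋₊ n,
      Filter.Tendsto (fun n => (c n).pe W) Filter.atTop (nhds 0)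

/-- The capacity region of communication with adversary identification. -/
def capacityRegion (W : Channel 𝒳 𝒴 𝒵) : Set (ℝ × ℝ) :=
  closure {R | IsAchievable W R}

end Coding

end ByzantineMAC

namespace ByzantineMAC

open Finset

section SeqProb

variable {ι α : Type*} [Fintype ι] [DecidableEq ι] [Fintype α]

open Classical in
/-- The mass that the product of the weight functions `p t` gives to a set of sequences. -/
noncomputable def seqProb (p : ι → α → ℝ) (S : Set (ι → α)) : ℝ :=
  ∑ z : ι → α with z ∈ S, ∏ t, p t (z t)

theorem seqProb_nonneg {p : ι → α → ℝ} (hp : ∀ t a, 0 ≤ p t a) (S : Set (ι → α)) :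
    0 ≤ seqProb p S :=
  sum_nonneg fun z _ => prod_nonneg fun t _ => hp t (z t)

theorem seqProb_mono {p : ι → α → ℝ} (hp : ∀ t a, 0 ≤ p t a) {S T : Set (ι → α)} (h : S ⊆ T) :
    seqProb p S ≤ seqProb p T := by
  classical
  refine sum_le_sum_of_subset_of_nonneg (fun z hz => ?_) fun z _ _ => prod_nonneg fun t _ => hp t _
  simp only [mem_filter, mem_univ, true_and] at hz ⊢
  exact h hz

theorem seqProb_univ {p : ι → α → ℝ} (hp : ∀ t, ∑ a, p t a = 1) : seqProb p Set.univ = 1 := by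
  classical
  have h := Finset.prod_univ_sum (fun _ : ι => (univ : Finset α)) p
  rw [Fintype.piFinset_univ] at h
  simp [seqProb, ← h, hp]

theorem seqProb_le_one {p : ι → α → ℝ} (hp : ∀ t a, 0 ≤ p t a) (hp1 : ∀ t, ∑ a, p t a = 1)
    (S : Set (ι → α)) : seqProb p S ≤ 1 :=
  (seqProb_mono hp (Set.subset_univ S)).trans (seqProb_univ hp1).le

theorem seqProb_union_le {p : ι → α → ℝ} (hp : ∀ t a, 0 ≤ p t a) (S T : Set (ι → α)) :
    seqProb p (S ∪ T) ≤ seqProb p S + seqProb p T := by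
  classical
  unfold seqProb
  rw [← sum_union_inter]
  refine le_trans (le_of_eq ?_) (le_add_of_nonneg_right
    (sum_nonneg fun z _ => prod_nonneg fun t _ => hp t (z t)))
  congr 1
  ext z
  simp

theorem seqProb_iUnion_le {κ : Type*} [Fintype κ] {p : ι → α → ℝ} (hp : ∀ t a, 0 ≤ p t a)
    (S : κ → Set (ι → α)) : seqProb p (⋃ k, S k) ≤ ∑ k, seqProb p (S k) := by
  classical
  unfold seqProb
  simp only [sum_filter]
  rw [sum_comm]
  refine sum_le_sum fun z _ => ?_
  have h0 : 0 ≤ ∏ t, p t (z t) := prod_nonneg fun t _ => hp t (z t)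
  split_ifs with h
  · obtain ⟨k, hk⟩ := Set.mem_iUnion.1 h
    calc _ = if z ∈ S k then ∏ t, p t (z t) else 0 := by simp [hk]
      _ ≤ _ := single_le_sum (f := fun k => if z ∈ S k then ∏ t, p t (z t) else 0)
        (fun k _ => by split_ifs <;> simp [h0]) (mem_univ k)
  · exact sum_nonneg fun k _ => by split_ifs <;> simp [h0]

theorem seqProb_iUnion_le_of_le {κ : Type*} [Fintype κ] {p : ι → α → ℝ}
    (hp : ∀ t a, 0 ≤ p t a) (S : κ → Set (ι → α)) {b : ℝ} (h : ∀ k, seqProb p (S k) ≤ b) :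
    seqProb p (⋃ k, S k) ≤ Fintype.card κ * b := by
  refine (seqProb_iUnion_le hp S).trans ((sum_le_sum fun k _ => h k).trans ?_)
  simp

theorem seqProb_uniform (S : Set (ι → α)) [DecidablePred (· ∈ S)] :
    seqProb (fun _ _ => (Fintype.card α : ℝ)⁻¹) S
      = (#{z | z ∈ S} : ℝ) / (Fintype.card (ι → α) : ℝ) := by
  classical
  unfold seqProb
  simp only [prod_const]
  rw [sum_const, nsmul_eq_mul, Fintype.card_fun, div_eq_mul_inv]
  congr 1
  · congr!
  · simp

theorem exp_moment_le {p g : α → ℝ} (hp : ∀ a, 0 ≤ p a) (hp1 : ∑ a, p a = 1)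
    (hg : ∀ a, |g a| ≤ 1) (hm : ∑ a, p a * g a = 0) {s : ℝ} (hs : |s| ≤ 1) :
    ∑ a, p a * Real.exp (s * g a) ≤ Real.exp (s ^ 2) := by
  have key : ∀ a, p a * Real.exp (s * g a) ≤ p a + s * (p a * g a) + p a * s ^ 2 := by
    intro a
    have h1 : |s * g a| ≤ 1 := by
      rw [abs_mul]; exact mul_le_one₀ hs (abs_nonneg _) (hg a)
    have h2 := (abs_le.1 (Real.abs_exp_sub_one_sub_id_le h1)).2
    have h3 : (s * g a) ^ 2 ≤ s ^ 2 := by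
      rw [mul_pow]
      exact mul_le_of_le_one_right (sq_nonneg s) ((sq_le_one_iff_abs_le_one _).2 (hg a))
    calc p a * Real.exp (s * g a) ≤ p a * (1 + s * g a + s ^ 2) :=
          mul_le_mul_of_nonneg_left (by linarith) (hp a)
      _ = _ := by ring
  calc ∑ a, p a * Real.exp (s * g a) ≤ ∑ a, (p a + s * (p a * g a) + p a * s ^ 2) :=
        sum_le_sum fun a _ => key a
    _ = s ^ 2 + 1 := by
        rw [sum_add_distrib, sum_add_distrib, ← mul_sum, ← sum_mul, hm, hp1]; ring
    _ ≤ _ := Real.add_one_le_exp _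

theorem seqProb_upper_tail {p g : ι → α → ℝ} (hp : ∀ t a, 0 ≤ p t a) (hp1 : ∀ t, ∑ a, p t a = 1)
    (hg : ∀ t a, |g t a| ≤ 1) (hm : ∀ t, ∑ a, p t a * g t a = 0) {δ : ℝ} (hδ0 : 0 ≤ δ)
    (hδ : δ ≤ 2) :
    seqProb p {z | δ * Fintype.card ι < ∑ t, g t (z t)}
      ≤ Real.exp (-(δ ^ 2 / 4 * Fintype.card ι)) := by
  classical
  set n : ℝ := (Fintype.card ι : ℝ)
  set s : ℝ := δ / 2
  have h1 : seqProb p {z | δ * n < ∑ t, g t (z t)}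
      ≤ ∑ z : ι → α, Real.exp (-(s * (δ * n))) * ∏ t, (p t (z t) * Real.exp (s * g t (z t))) := by
    unfold seqProb
    rw [sum_filter]
    refine sum_le_sum fun z _ => ?_
    have h0 : 0 ≤ ∏ t, p t (z t) := prod_nonneg fun t _ => hp t (z t)
    rw [prod_mul_distrib, ← Real.exp_sum, ← mul_sum, mul_left_comm, ← Real.exp_add]
    split_ifs with h
    · have h' : δ * n < ∑ t, g t (z t) := h
      refine le_mul_of_one_le_right h0 (Real.one_le_exp ?_)
      have : s * (δ * n) ≤ s * ∑ t, g t (z t) :=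
        mul_le_mul_of_nonneg_left h'.le (by positivity)
      linarith
    · positivity
  refine h1.trans ?_
  rw [← mul_sum]
  have h2 := Finset.prod_univ_sum (fun _ : ι => (univ : Finset α))
    (fun t a => p t a * Real.exp (s * g t a))
  rw [Fintype.piFinset_univ] at h2
  rw [← h2]
  have h3 : ∏ t, ∑ a, p t a * Real.exp (s * g t a) ≤ ∏ _t : ι, Real.exp (s ^ 2) :=
    prod_le_prod (fun t _ => sum_nonneg fun a _ => mul_nonneg (hp t a) (Real.exp_pos _).le)
      fun t _ => exp_moment_le (hp t) (hp1 t) (hg t) (hm t) (by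
        rw [abs_of_nonneg (by positivity)]; simp only [s]; linarith)
  refine (mul_le_mul_of_nonneg_left h3 (Real.exp_pos _).le).trans (le_of_eq ?_)
  rw [prod_const, ← Real.exp_nat_mul, ← Real.exp_add, card_univ]
  congr 1
  simp only [s, n]
  ring

/-- Hoeffding's inequality for sequences of independent symbols. -/
theorem seqProb_hoeffding {p g : ι → α → ℝ} (hp : ∀ t a, 0 ≤ p t a) (hp1 : ∀ t, ∑ a, p t a = 1)
    (hg : ∀ t a, |g t a| ≤ 1) (hm : ∀ t, ∑ a, p t a * g t a = 0) {δ : ℝ} (hδ0 : 0 ≤ δ)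
    (hδ : δ ≤ 2) :
    seqProb p {z | δ * Fintype.card ι < |∑ t, g t (z t)|}
      ≤ 2 * Real.exp (-(δ ^ 2 / 4 * Fintype.card ι)) := by
  have h1 := seqProb_upper_tail hp hp1 hg hm hδ0 hδ
  have h2 := seqProb_upper_tail (g := fun t a => -g t a) hp hp1 (by simpa using hg)
    (by simpa using hm) hδ0 hδ
  refine (seqProb_mono hp ?_).trans ((seqProb_union_le hp _ _).trans
    ((add_le_add h1 h2).trans (two_mul _).ge))
  intro z hz
  simpa [lt_abs] using hz

theorem sum_prod_mul_seqProb {β : Type*} [Fintype β] (q : ι → β → ℝ) (u : ι → β → α → ℝ)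
    (S : Set (ι → α)) :
    ∑ y : ι → β, (∏ t, q t (y t)) * seqProb (fun t => u t (y t)) S
      = seqProb (fun t z => ∑ b, q t b * u t b z) S := by
  classical
  unfold seqProb
  simp only [mul_sum]
  rw [sum_comm]
  refine sum_congr rfl fun z _ => ?_
  have h := Finset.prod_univ_sum (fun _ : ι => (univ : Finset β)) (fun t b => q t b * u t b (z t))
  rw [Fintype.piFinset_univ] at h
  rw [h]
  simp [prod_mul_distrib]

end SeqProb

theorem simplex_nonneg {α : Type*} [Fintype α] (p : stdSimplex ℝ α) (a : α) : 0 ≤ p a := p.2.1 a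

theorem simplex_sum {α : Type*} [Fintype α] (p : stdSimplex ℝ α) : ∑ a, p a = 1 := p.2.2

theorem simplex_le_one {α : Type*} [Fintype α] (p : stdSimplex ℝ α) (a : α) : p a ≤ 1 :=
  (single_le_sum (fun b _ => simplex_nonneg p b) (mem_univ a)).trans (simplex_sum p).le

theorem Channel.prodProb_eq_seqProb {𝒳 𝒴 𝒵 : Type*} [Fintype 𝒵] (W : Channel 𝒳 𝒴 𝒵) {n : ℕ}
    (S : Set (Fin n → 𝒵)) (x : Fin n → 𝒳) (y : Fin n → 𝒴) :
    W.prodProb S x y = seqProb (fun t => (W (x t) (y t) : 𝒵 → ℝ)) S := rfl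

section ProdProb

variable {𝒳 𝒴 𝒵 : Type*} [Fintype 𝒵] (W : Channel 𝒳 𝒴 𝒵) {n : ℕ} (x : Fin n → 𝒳) (y : Fin n → 𝒴)

theorem Channel.prodProb_nonneg (S : Set (Fin n → 𝒵)) : 0 ≤ W.prodProb S x y := by
  rw [prodProb_eq_seqProb]
  exact seqProb_nonneg (fun t d => simplex_nonneg _ _) S

theorem Channel.prodProb_mono {S T : Set (Fin n → 𝒵)} (h : S ⊆ T) :
    W.prodProb S x y ≤ W.prodProb T x y := by
  simp only [prodProb_eq_seqProb]
  exact seqProb_mono (fun t d => simplex_nonneg _ _) h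

theorem Channel.prodProb_union_le (S T : Set (Fin n → 𝒵)) :
    W.prodProb (S ∪ T) x y ≤ W.prodProb S x y + W.prodProb T x y := by
  simp only [prodProb_eq_seqProb]
  exact seqProb_union_le (fun t d => simplex_nonneg _ _) S T

end ProdProb

/-- The channel with the roles of the two users exchanged. -/
def Channel.swap {𝒳 𝒴 𝒵 : Type*} [Fintype 𝒵] (W : Channel 𝒳 𝒴 𝒵) : Channel 𝒴 𝒳 𝒵 :=
  fun y x => W x y

theorem isASpoofable_swap_iff {𝒳 𝒴 𝒵 : Type*} [Fintype 𝒳] [Fintype 𝒴] [Fintype 𝒵]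
    (W : Channel 𝒳 𝒴 𝒵) : IsASpoofable W.swap ↔ IsBSpoofable W := by
  constructor
  · rintro ⟨QX, QY, h⟩
    exact ⟨fun x y => QX y x, QY, fun xt yt y' z => h y' yt xt z⟩
  · rintro ⟨QX, QY, h⟩
    exact ⟨fun y x => QX x y, QY, fun y' yt xt z => h xt yt y' z⟩

section Converse

variable {P Q 𝒵 : Type*} [Fintype P] [Fintype Q] [Fintype 𝒵] {n : ℕ}

theorem sum_seqProb_mixture_le {I : Type*} [Fintype I] (U : I → Fin n → Q → 𝒵 → ℝ)
    (q : Fin n → stdSimplex ℝ Q) (E : I → Set (Fin n → 𝒵)) {e : ℝ}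
    (h : ∀ y : Fin n → Q, ∑ m, seqProb (fun t => U m t (y t)) (E m) ≤ e) :
    ∑ m, seqProb (fun t z => ∑ b, q t b * U m t b z) (E m) ≤ e := by
  classical
  simp only [← sum_prod_mul_seqProb]
  rw [sum_comm]
  simp only [← mul_sum]
  refine (sum_le_sum fun y _ => mul_le_mul_of_nonneg_left (h y)
    (prod_nonneg fun t _ => simplex_nonneg (q t) (y t))).trans ?_
  rw [← sum_mul]
  have h2 := seqProb_univ (p := fun t => (q t : Q → ℝ)) fun t => simplex_sum (q t)
  simp only [seqProb, Set.mem_univ, filter_true] at h2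
  rw [h2, one_mul]

theorem mixture_mass (q : stdSimplex ℝ Q) (u : Q → stdSimplex ℝ 𝒵) :
    ∑ z, ∑ b, q b * u b z = 1 := by
  rw [sum_comm]
  simp [← mul_sum]

/-- If user A can be spoofed then a code with few errors has a single message for user A. -/
theorem IsASpoofable.card_le {U : Channel P Q 𝒵} (hU : IsASpoofable U) {NA NB : ℕ}
    (f : Fin NA → Fin n → P) (g : Fin NB → Fin n → Q)
    (EA : Fin NA → Set (Fin n → 𝒵)) (EB : Fin NB → Set (Fin n → 𝒵))
    (hcov : ∀ i j k, i ≠ j → EA i ∪ EA j ∪ EB k = Set.univ) {e : ℝ}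
    (hA : ∀ y, (1 / (NA : ℝ)) * ∑ i, U.prodProb (EA i) (f i) y ≤ e)
    (hB : ∀ x, (1 / (NB : ℝ)) * ∑ k, U.prodProb (EB k) x (g k) ≤ e)
    (hNA : 0 < NA) (hNB : 0 < NB) : 1 - 1 / (NA : ℝ) ≤ 3 * e := by
  classical
  obtain ⟨QY, QX, hQ⟩ := hU
  have hNA' : (0 : ℝ) < NA := by exact_mod_cast hNA
  have hNB' : (0 : ℝ) < NB := by exact_mod_cast hNB
  set D : Fin NA → Fin NA → Fin NB → Set (Fin n → 𝒵) → ℝ := fun i j k S =>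
    seqProb (fun t z => ∑ y, QY (f j t) (g k t) y * U (f i t) y z) S with hD
  have hD2 : ∀ i j k S, D i j k S = D j i k S := by
    intro i j k S
    simp only [hD]
    congr 1
    funext t z
    exact (hQ (f i t) (f j t) (g k t) z).1
  have hD3 : ∀ i j k S,
      D i j k S = seqProb (fun t z => ∑ x, QX (f j t) (f i t) x * U x (g k t) z) S := by
    intro i j k S
    simp only [hD]
    congr 1
    funext t z
    exact (hQ (f i t) (f j t) (g k t) z).1.trans (hQ (f i t) (f j t) (g k t) z).2
  have hnn : ∀ i j k t z, (0 : ℝ) ≤ ∑ y, QY (f j t) (g k t) y * U (f i t) y z := fun i j k t z =>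
    sum_nonneg fun y _ => mul_nonneg (simplex_nonneg _ _) (simplex_nonneg _ _)
  have h0 : ∀ i j k S, 0 ≤ D i j k S := fun i j k S => seqProb_nonneg (hnn i j k) S
  have h1 : ∀ i j k, (if i = j then (0 : ℝ) else 1)
      ≤ D i j k (EA i) + D i j k (EA j) + D i j k (EB k) := by
    intro i j k
    split_ifs with hij
    · have := h0 i j k (EA i); have := h0 i j k (EA j); have := h0 i j k (EB k); linarith
    · have e1 : D i j k Set.univ = 1 := seqProb_univ fun t => mixture_mass _ _
      rw [← hcov i j k hij] at e1
      have e2 : D i j k (EA i ∪ EA j ∪ EB k) ≤ D i j k (EA i ∪ EA j) + D i j k (EB k) :=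
        seqProb_union_le (hnn i j k) _ _
      have e3 : D i j k (EA i ∪ EA j) ≤ D i j k (EA i) + D i j k (EA j) :=
        seqProb_union_le (hnn i j k) _ _
      linarith
  have hA' : ∀ y, ∑ i, U.prodProb (EA i) (f i) y ≤ NA * e := fun y => by
    have := hA y
    rwa [one_div, inv_mul_le_iff₀ hNA'] at this
  have hB' : ∀ x, ∑ k, U.prodProb (EB k) x (g k) ≤ NB * e := fun x => by
    have := hB x
    rwa [one_div, inv_mul_le_iff₀ hNB'] at this
  have s1 : ∀ j k, ∑ i, D i j k (EA i) ≤ NA * e := fun j k =>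
    sum_seqProb_mixture_le (fun i t b => (U (f i t) b : 𝒵 → ℝ)) (fun t => QY (f j t) (g k t)) EA hA'
  have s2 : ∀ i k, ∑ j, D i j k (EA j) ≤ NA * e := fun i k => by
    simpa only [hD2 i] using s1 i k
  have s3 : ∀ i j, ∑ k, D i j k (EB k) ≤ NB * e := fun i j => by
    simp only [hD3]
    exact sum_seqProb_mixture_le (fun k t b => (U b (g k t) : 𝒵 → ℝ))
      (fun t => QX (f j t) (f i t)) EB hB'
  have t0 : ∑ i : Fin NA, ∑ j : Fin NA, ∑ _k : Fin NB, (if i = j then (0 : ℝ) else 1)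
      = (NA * NA - NA) * NB := by
    have : ∀ i j : Fin NA, (if i = j then (0 : ℝ) else 1) = 1 - if i = j then 1 else 0 := by
      intro i j; split_ifs <;> simp
    simp only [this, sum_const, card_univ, Fintype.card_fin, nsmul_eq_mul, ← mul_sum,
      sum_sub_distrib, sum_ite_eq, mem_univ, if_true]
    ring
  have t1 : ∑ i, ∑ j, ∑ k, D i j k (EA i) ≤ NA * NB * (NA * e) := by
    have : ∑ i, ∑ j, ∑ k, D i j k (EA i) = ∑ j, ∑ k, ∑ i, D i j k (EA i) := by
      rw [sum_comm]; exact sum_congr rfl fun j _ => sum_comm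
    rw [this]
    refine (sum_le_sum fun j _ => sum_le_sum fun k _ => s1 j k).trans (le_of_eq ?_)
    simp; ring
  have t2 : ∑ i, ∑ j, ∑ k, D i j k (EA j) ≤ NA * NB * (NA * e) := by
    have : ∑ i, ∑ j, ∑ k, D i j k (EA j) = ∑ i, ∑ k, ∑ j, D i j k (EA j) :=
      sum_congr rfl fun j _ => sum_comm
    rw [this]
    refine (sum_le_sum fun j _ => sum_le_sum fun k _ => s2 j k).trans (le_of_eq ?_)
    simp; ring
  have t3 : ∑ i, ∑ j, ∑ k, D i j k (EB k) ≤ NA * NA * (NB * e) := by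
    refine (sum_le_sum fun i _ => sum_le_sum fun j _ => s3 i j).trans (le_of_eq ?_)
    simp; ring
  have t4 := sum_le_sum fun i (_ : i ∈ univ) => sum_le_sum fun j (_ : j ∈ univ) =>
    sum_le_sum fun k (_ : k ∈ univ) => h1 i j k
  rw [t0] at t4
  simp only [sum_add_distrib] at t4
  have t5 : (1 - 1 / (NA : ℝ)) * (NA * NA * NB) ≤ 3 * e * (NA * NA * NB) := by
    have : (1 - 1 / (NA : ℝ)) * (NA * NA * NB) = (NA * NA - NA) * NB := by field_simp
    rw [this]; linarith
  exact le_of_mul_le_mul_right t5 (by positivity)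

end Converse

/-- A digraph whose out-degrees are at most two has an independent set of a fifth of its size. -/
theorem exists_independent_of_outdegree_le_two {I : Type*} [DecidableEq I] (nb : I → Finset I)
    (h0 : ∀ i, i ∉ nb i) (h2 : ∀ i, #(nb i) ≤ 2) (K : ℕ) (T : Finset I) (hT : 5 * K ≤ #T) :
    ∃ S ⊆ T, #S = K ∧ ∀ i ∈ S, ∀ j ∈ nb i, j ∉ S := by
  induction K generalizing T with
  | zero => exact ⟨∅, by simp⟩
  | succ K ih =>
    have hne : T.Nonempty := card_pos.1 (by omega)
    have hsum : ∑ v ∈ T, #{i ∈ T | v ∈ nb i} ≤ ∑ _v ∈ T, 2 := by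
      have e : ∑ v ∈ T, #{i ∈ T | v ∈ nb i} = ∑ i ∈ T, #{v ∈ T | v ∈ nb i} := by
        simp only [card_filter]; exact sum_comm
      rw [e]
      refine sum_le_sum fun i _ => le_trans (card_le_card fun v hv => ?_) (h2 i)
      exact (mem_filter.1 hv).2
    obtain ⟨v, hv, hdeg⟩ := exists_le_of_sum_le hne hsum
    set R : Finset I := {v} ∪ nb v ∪ {i ∈ T | v ∈ nb i}
    have hR : #R ≤ 5 := by
      have a := card_union_le ({v} ∪ nb v) {i ∈ T | v ∈ nb i}
      have b := card_union_le {v} (nb v)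
      have c := h2 v
      rw [card_singleton] at b
      simp only [R]
      omega
    have hcard := le_card_sdiff R T
    obtain ⟨S, hST, hSK, hS⟩ := ih (T \ R) (by omega)
    have hvS : v ∉ S := fun h => (mem_sdiff.1 (hST h)).2 (by simp [R])
    refine ⟨insert v S, ?_, by rw [card_insert_of_notMem hvS, hSK], ?_⟩
    · intro i hi
      rcases mem_insert.1 hi with rfl | hi
      · exact hv
      · exact (mem_sdiff.1 (hST hi)).1
    · intro i hi j hj hjS
      rcases mem_insert.1 hi with rfl | hi'
      · rcases mem_insert.1 hjS with rfl | hjS'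
        · exact h0 _ hj
        · exact (mem_sdiff.1 (hST hjS')).2 (by simp [R, hj])
      · rcases mem_insert.1 hjS with rfl | hjS'
        · exact (mem_sdiff.1 (hST hi')).2 (by
            simp [R, hj, (mem_sdiff.1 (hST hi')).1])
        · exact hS i hi' j hj hjS'

section RandomCode

variable {I V : Type*} [Fintype I] [DecidableEq I] [Fintype V] [DecidableEq V]

theorem card_fixed_positions_le {K : ℕ} (e : Fin K → I) (he : Function.Injective e)
    (u w : Fin K → I) (hu : ∀ k l, u k ≠ e l) (hw : ∀ k l, w k ≠ e l)
    (B : V → V → Finset V) {β : ℝ} (hB : ∀ v v', (#(B v v') : ℝ) ≤ β * Fintype.card V) :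
    (#{f : I → V | ∀ k, f (e k) ∈ B (f (u k)) (f (w k))} : ℝ)
      ≤ β ^ K * Fintype.card (I → V) := by
  classical
  let J := {i : I // i ∉ Set.range e}
  let u' : Fin K → J := fun k => ⟨u k, by rintro ⟨l, hl⟩; exact hu k l hl.symm⟩
  let w' : Fin K → J := fun k => ⟨w k, by rintro ⟨l, hl⟩; exact hw k l hl.symm⟩
  have h1 : #{f : I → V | ∀ k, f (e k) ∈ B (f (u k)) (f (w k))}
      ≤ #((univ : Finset (J → V)).sigma
        fun b => Fintype.piFinset fun k => B (b (u' k)) (b (w' k))) := by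
    refine card_le_card_of_injOn (fun f => ⟨fun j => f j.1, fun k => f (e k)⟩) ?_ ?_
    · intro f hf
      have hf' : ∀ k, f (e k) ∈ B (f (u k)) (f (w k)) := by simpa using hf
      simpa [u', w'] using hf'
    · intro f _ g _ hfg
      simp only [Sigma.mk.injEq, heq_eq_eq] at hfg
      funext i
      by_cases hi : i ∈ Set.range e
      · obtain ⟨k, rfl⟩ := hi
        exact congrFun hfg.2 k
      · exact congrFun hfg.1 ⟨i, hi⟩
  have h2 : Fintype.card J + K = Fintype.card I := by
    have a := Fintype.card_subtype_compl (fun i => i ∈ Set.range e)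
    have b : Fintype.card {i // i ∈ Set.range e} = K := by
      rw [← Fintype.card_congr (Equiv.ofInjective e he), Fintype.card_fin]
    have c := Fintype.card_subtype_le (fun i => i ∈ Set.range e)
    have d : Fintype.card J = Fintype.card {i // ¬ i ∈ Set.range e} := by
      simp only [J]
    omega
  calc (#{f : I → V | ∀ k, f (e k) ∈ B (f (u k)) (f (w k))} : ℝ)
      ≤ ∑ b : J → V, ∏ k, (#(B (b (u' k)) (b (w' k))) : ℝ) := by
        refine (Nat.cast_le.2 h1).trans (le_of_eq ?_)
        rw [card_sigma]
        push_cast [Fintype.card_piFinset]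
        rfl
    _ ≤ ∑ _b : J → V, ∏ _k : Fin K, β * (Fintype.card V : ℝ) :=
        sum_le_sum fun b _ => prod_le_prod (fun k _ => Nat.cast_nonneg _) fun k _ => hB _ _
    _ = β ^ K * Fintype.card (I → V) := by
        simp only [sum_const, card_univ, prod_const, Fintype.card_fin, nsmul_eq_mul,
          Fintype.card_fun, Nat.cast_pow, ← h2]
        ring

/-- Random coding: there is a codebook such that, whatever the side information `y`, only a bounded
number of codewords fall into a small exceptional set determined by two other codewords
and `y`. -/
theorem exists_code_few_exceptional {Y : Type*} [Fintype Y] [Nonempty V]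
    (B : Y → V → V → Finset V) {β : ℝ} (hB : ∀ y v v', (#(B y v v') : ℝ) ≤ β * Fintype.card V)
    (K : ℕ) (h : Fintype.card Y * ((Fintype.card I : ℝ) ^ 3 * β) ^ K < 1) :
    ∃ f : I → V, ∀ y, ∃ T : Finset I, #T ≤ 5 * K ∧
      ∀ i ∉ T, ∀ j k, j ≠ i → k ≠ i → f i ∉ B y (f j) (f k) := by
  classical
  by_contra hcon
  push Not at hcon
  let Idx := Y × (Fin K → I × I × I)
  let Ev : Idx → Finset (I → V) := fun τ =>
    if Function.Injective (fun k => (τ.2 k).1) ∧ (∀ k l, (τ.2 k).2.1 ≠ (τ.2 l).1) ∧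
      (∀ k l, (τ.2 k).2.2 ≠ (τ.2 l).1)
    then Finset.univ.filter
      fun f : I → V => ∀ k, f (τ.2 k).1 ∈ B τ.1 (f (τ.2 k).2.1) (f (τ.2 k).2.2)
    else ∅
  have hβ : 0 ≤ β ^ K * Fintype.card (I → V) ∨ IsEmpty Y := by
    rcases isEmpty_or_nonempty Y with hY | ⟨⟨y⟩⟩
    · exact Or.inr hY
    · obtain ⟨v⟩ := ‹Nonempty V›
      have h1 := (Nat.cast_nonneg (α := ℝ) (#(B y v v))).trans (hB y v v)
      have h2 : (0 : ℝ) < Fintype.card V := by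
        exact_mod_cast Fintype.card_pos_iff.2 ⟨v⟩
      have : 0 ≤ β := nonneg_of_mul_nonneg_left h1 h2
      exact Or.inl (by positivity)
  have hEv : ∀ τ, (#(Ev τ) : ℝ) ≤ β ^ K * Fintype.card (I → V) := by
    intro τ
    simp only [Ev]
    split_ifs with hτ
    · exact card_fixed_positions_le _ hτ.1 _ _ hτ.2.1 hτ.2.2 (B τ.1) (hB τ.1)
    · rcases hβ with hβ | hY
      · simpa using hβ
      · exact hY.elim τ.1
  have hcover : (univ : Finset (I → V)) ⊆ univ.biUnion Ev := by
    intro f _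
    obtain ⟨y, hy⟩ := hcon f
    let T : Finset I := {i | ∃ j k, j ≠ i ∧ k ≠ i ∧ f i ∈ B y (f j) (f k)}
    have hT : 5 * K ≤ #T := by
      by_contra hlt
      obtain ⟨i, hi, j, k, hj, hk, hb⟩ := hy T (by omega)
      exact hi (by simp only [T, mem_filter, mem_univ, true_and]; exact ⟨j, k, hj, hk, hb⟩)
    have hg : ∀ i, ∃ p : I × I, i ∈ T → p.1 ≠ i ∧ p.2 ≠ i ∧ f i ∈ B y (f p.1) (f p.2) := by
      intro i
      by_cases hi : i ∈ T
      · obtain ⟨j, k, hjk⟩ := (mem_filter.1 hi).2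
        exact ⟨(j, k), fun _ => hjk⟩
      · exact ⟨(i, i), fun h => (hi h).elim⟩
    choose g hg using hg
    obtain ⟨S, hST, hSK, hS⟩ := exists_independent_of_outdegree_le_two
      (fun i => if i ∈ T then {(g i).1, (g i).2} else ∅)
      (fun i => by
        split_ifs with hi
        · have := hg i hi
          simp [this.1.symm, this.2.1.symm]
        · simp)
      (fun i => by
        split_ifs
        · exact card_le_two
        · simp) K T hT
    let e : Fin K ≃ S := (S.equivFinOfCardEq hSK).symm
    refine mem_biUnion.2 ⟨(y, fun k => ((e k : I), g (e k))), mem_univ _, ?_⟩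
    have hSnb : ∀ i ∈ S, (g i).1 ∉ S ∧ (g i).2 ∉ S := fun i hi => by
      have := hS i hi
      simp only [if_pos (hST hi)] at this
      exact ⟨this _ (by simp), this _ (by simp)⟩
    have hc : Function.Injective (fun k => (e k : I)) ∧ (∀ k l, (g (e k)).1 ≠ (e l : I)) ∧
        (∀ k l, (g (e k)).2 ≠ (e l : I)) := by
      refine ⟨Subtype.val_injective.comp e.injective, fun k l h => ?_, fun k l h => ?_⟩
      · exact (hSnb _ (e k).2).1 (h ▸ (e l).2)
      · exact (hSnb _ (e k).2).2 (h ▸ (e l).2)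
    simp only [Ev]
    rw [if_pos hc, mem_filter]
    exact ⟨mem_univ _, fun k => (hg _ (hST (e k).2)).2.2⟩
  have h1 : (Fintype.card (I → V) : ℝ) ≤ ∑ τ, (#(Ev τ) : ℝ) := by
    have := (card_le_card hcover).trans card_biUnion_le
    rw [card_univ] at this
    exact_mod_cast this
  have h2 : (Fintype.card (I → V) : ℝ)
      ≤ Fintype.card Y * ((Fintype.card I : ℝ) ^ 3 * β) ^ K * Fintype.card (I → V) := by
    refine h1.trans ((sum_le_sum fun τ _ => hEv τ).trans (le_of_eq ?_))
    simp only [sum_const, card_univ, Idx, Fintype.card_prod, Fintype.card_fun, Fintype.card_fin,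
      nsmul_eq_mul]
    push_cast
    ring
  have h3 : (0 : ℝ) < Fintype.card (I → V) := by exact_mod_cast Fintype.card_pos
  nlinarith

end RandomCode

open Classical in
/-- The number of positions at which `p` holds. -/
noncomputable def cnt {n : ℕ} (p : Fin n → Prop) : ℝ := ∑ t, if p t then 1 else 0

theorem cnt_nonneg {n : ℕ} (p : Fin n → Prop) : 0 ≤ cnt p :=
  sum_nonneg fun t _ => by split_ifs <;> simp

theorem sum_cnt_eq {n : ℕ} {α : Type*} [Fintype α] (p : Fin n → Prop) (y : Fin n → α) :
    ∑ e, cnt (fun t => p t ∧ y t = e) = cnt p := by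
  classical
  unfold cnt
  rw [sum_comm]
  refine sum_congr rfl fun t _ => ?_
  by_cases h : p t <;> simp [h]

theorem sum_cnt_mul {n : ℕ} {α : Type*} [Fintype α] (p : Fin n → Prop) [DecidablePred p]
    (y : Fin n → α) (u : α → ℝ) :
    ∑ e, cnt (fun t => p t ∧ y t = e) * u e = ∑ t, if p t then u (y t) else 0 := by
  classical
  unfold cnt
  simp only [sum_mul]
  rw [sum_comm]
  refine sum_congr rfl fun t _ => ?_
  by_cases h : p t <;> simp [h]

theorem exists_conditional {n : ℕ} {α : Type*} [Fintype α] [Nonempty α] (p : Fin n → Prop)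
    (y : Fin n → α) :
    ∃ q : stdSimplex ℝ α, ∀ e, cnt (fun t => p t ∧ y t = e) = cnt p * q e := by
  classical
  have hs := sum_cnt_eq p y
  by_cases h : cnt p = 0
  · obtain ⟨a⟩ := ‹Nonempty α›
    refine ⟨⟨Pi.single a 1, single_mem_stdSimplex ℝ a⟩, fun e => ?_⟩
    rw [h] at hs ⊢
    rw [zero_mul]
    exact (sum_eq_zero_iff_of_nonneg fun e _ => cnt_nonneg _).1 hs e (mem_univ e)
  · refine ⟨⟨fun e => cnt (fun t => p t ∧ y t = e) / cnt p,
      fun e => div_nonneg (cnt_nonneg _) (cnt_nonneg _), ?_⟩, fun e => ?_⟩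
    · rw [← sum_div, hs, div_self h]
    · exact (mul_div_cancel₀ _ h).symm

section Codebook

variable {𝒜 : Type*} [Fintype 𝒜] {n : ℕ}

/-- The codeword `x` deviates from being uniform and independent of `(v, w, y)`. -/
def IsExceptional (δ : ℝ) (y v w x : Fin n → 𝒜) : Prop :=
  ∃ h : 𝒜 → 𝒜 → 𝒜 → 𝒜 → Bool,
    δ * n < |∑ t, ((if h (x t) (v t) (w t) (y t) then (1 : ℝ) else 0)
      - (Fintype.card 𝒜 : ℝ)⁻¹ * ∑ a, if h a (v t) (w t) (y t) then (1 : ℝ) else 0)|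

theorem abs_cnt_sub_le_of_not_isExceptional {δ : ℝ} {y v w x : Fin n → 𝒜}
    (h : ¬ IsExceptional δ y v w x) (a : 𝒜) (p : 𝒜 → 𝒜 → 𝒜 → Prop) :
    |cnt (fun t => x t = a ∧ p (v t) (w t) (y t))
      - (Fintype.card 𝒜 : ℝ)⁻¹ * cnt (fun t => p (v t) (w t) (y t))| ≤ δ * n := by
  classical
  unfold IsExceptional at h
  push Not at h
  refine le_trans (le_of_eq ?_) (h fun a' b c d => decide (a' = a ∧ p b c d))
  congr 1
  unfold cnt
  rw [mul_sum, ← sum_sub_distrib]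
  refine sum_congr rfl fun t _ => ?_
  by_cases hp : p (v t) (w t) (y t) <;> simp [hp]

theorem abs_cnt_pair_sub_le [Nonempty 𝒜] {δ : ℝ} {y v w : Fin n → 𝒜}
    (hv : ¬ IsExceptional δ y w w v) (hw : ¬ IsExceptional δ y v v w) (b c : 𝒜) :
    |cnt (fun t => v t = b ∧ w t = c) - n * (Fintype.card 𝒜 : ℝ)⁻¹ ^ 2| ≤ 2 * δ * n := by
  have hN : (1 : ℝ) ≤ Fintype.card 𝒜 := by exact_mod_cast Fintype.card_pos
  have h1 := abs_cnt_sub_le_of_not_isExceptional hv b fun c' _ _ => c' = c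
  have h2 := abs_cnt_sub_le_of_not_isExceptional hw c fun _ _ _ => True
  have h3 : cnt (fun _ : Fin n => True) = n := by simp [cnt]
  simp only [and_true] at h2
  rw [h3] at h2
  set N : ℝ := (Fintype.card 𝒜 : ℝ)
  have h4 : |N⁻¹ * cnt (fun t => w t = c) - N⁻¹ * (N⁻¹ * n)| ≤ δ * n := by
    rw [← mul_sub, abs_mul, abs_of_nonneg (by positivity)]
    exact (mul_le_of_le_one_left (abs_nonneg _) (inv_le_one_of_one_le₀ hN)).trans h2
  have h5 := (abs_sub_le _ _ _).trans (add_le_add h1 h4)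
  have e : N⁻¹ * (N⁻¹ * n) = n * N⁻¹ ^ 2 := by ring
  rw [e] at h5
  linarith

open Classical in
theorem card_isExceptional_le [Nonempty 𝒜] {δ : ℝ} (hδ0 : 0 ≤ δ) (hδ : δ ≤ 2)
    (y v w : Fin n → 𝒜) :
    (#{x | IsExceptional δ y v w x} : ℝ)
      ≤ Fintype.card (𝒜 → 𝒜 → 𝒜 → 𝒜 → Bool) * (2 * Real.exp (-(δ ^ 2 / 4 * n)))
        * Fintype.card (Fin n → 𝒜) := by
  have hN : (0 : ℝ) < Fintype.card 𝒜 := by exact_mod_cast Fintype.card_pos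
  have hV : (0 : ℝ) < Fintype.card (Fin n → 𝒜) := by exact_mod_cast Fintype.card_pos
  have hu : ∀ (_ : Fin n) (_ : 𝒜), (0 : ℝ) ≤ (Fintype.card 𝒜 : ℝ)⁻¹ := fun _ _ => by positivity
  rw [← div_le_iff₀ hV]
  have e := seqProb_uniform (α := 𝒜) {x : Fin n → 𝒜 | IsExceptional δ y v w x}
  simp only [Set.mem_ofPred_eq] at e
  rw [← e]
  have hset : {x : Fin n → 𝒜 | IsExceptional δ y v w x}
      = ⋃ h : 𝒜 → 𝒜 → 𝒜 → 𝒜 → Bool, {x |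
        δ * n < |∑ t, ((if h (x t) (v t) (w t) (y t) then (1 : ℝ) else 0)
      - (Fintype.card 𝒜 : ℝ)⁻¹ * ∑ a, if h a (v t) (w t) (y t) then (1 : ℝ) else 0)|} := by
    ext x; simp [IsExceptional]
  rw [hset]
  refine seqProb_iUnion_le_of_le hu _ fun h => ?_
  have key := seqProb_hoeffding (ι := Fin n) (p := fun _ _ => (Fintype.card 𝒜 : ℝ)⁻¹)
    (g := fun t x => (if h x (v t) (w t) (y t) then (1 : ℝ) else 0)
      - (Fintype.card 𝒜 : ℝ)⁻¹ * ∑ a, if h a (v t) (w t) (y t) then (1 : ℝ) else 0)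
    hu (fun t => by simp [hN.ne']) (fun t a => ?_) (fun t => ?_) hδ0 hδ
  · simpa only [Fintype.card_fin] using key
  · set m := (Fintype.card 𝒜 : ℝ)⁻¹ * ∑ a, if h a (v t) (w t) (y t) then (1 : ℝ) else 0
    have h0 : 0 ≤ m := mul_nonneg (by positivity)
      (sum_nonneg fun a _ => by split_ifs <;> simp)
    have h1 : m ≤ 1 := by
      rw [inv_mul_le_iff₀ hN, mul_one]
      refine (sum_le_sum fun a _ => (by split_ifs <;> simp : _ ≤ (1 : ℝ))).trans (by simp)
    rw [abs_le]
    split_ifs <;> constructor <;> linarith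
  · rw [← mul_sum, sum_sub_distrib, sum_const, card_univ, nsmul_eq_mul, ← mul_assoc,
      mul_inv_cancel₀ hN.ne', one_mul, sub_self, mul_zero]

theorem tendsto_exp_neg_mul_nat {c : ℝ} (hc : 0 < c) :
    Filter.Tendsto (fun n : ℕ => Real.exp (-(c * n))) Filter.atTop (nhds 0) :=
  Real.tendsto_exp_neg_atTop_nhds_zero.comp
    (tendsto_natCast_atTop_atTop.const_mul_atTop hc)

/-- Codebooks of small positive rate in which nearly all codewords are almost uniform and
independent of any two other codewords and any side information. -/
theorem exists_codebook (𝒜 : Type*) [Fintype 𝒜] [Nonempty 𝒜] {δ : ℝ} (hδ0 : 0 < δ) (hδ : δ ≤ 2) :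
    ∃ M n₀ : ℕ, ∀ n ≥ n₀, ∀ (I : Type) [Fintype I],
      (Fintype.card I : ℝ) ≤ 2 * Real.exp (δ ^ 2 / 24 * n) →
      ∃ f : I → Fin n → 𝒜, ∀ y, ∃ T : Finset I, #T ≤ M ∧
        ∀ i ∉ T, ∀ j k, j ≠ i → k ≠ i → ¬ IsExceptional δ y (f j) (f k) (f i) := by
  classical
  set ε : ℝ := δ ^ 2 / 24 with hε
  have hε0 : 0 < ε := by positivity
  set C : ℝ := Fintype.card (𝒜 → 𝒜 → 𝒜 → 𝒜 → Bool) * 2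
  have hC : 0 ≤ C := by positivity
  set N : ℝ := (Fintype.card 𝒜 : ℝ)
  have hN : 0 < N := by simp only [N]; exact_mod_cast Fintype.card_pos
  have ev1 : ∀ᶠ n : ℕ in Filter.atTop, 8 * C * Real.exp (-(ε * n)) < 1 := by
    have h := (tendsto_exp_neg_mul_nat hε0).const_mul (8 * C)
    rw [mul_zero] at h
    exact h.eventually (gt_mem_nhds one_pos)
  obtain ⟨K, hK⟩ : ∃ K : ℕ, N * Real.exp (-(ε * K)) < 1 := by
    have h := (tendsto_exp_neg_mul_nat hε0).const_mul N
    rw [mul_zero] at h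
    exact (h.eventually (gt_mem_nhds one_pos)).exists
  obtain ⟨n₀, hn₀⟩ := Filter.eventually_atTop.1 (ev1.and (Filter.eventually_ge_atTop 1))
  refine ⟨5 * K, n₀, fun n hn I _ hI => ?_⟩
  obtain ⟨hn1, hn2⟩ := hn₀ n hn
  set β : ℝ := C * Real.exp (-(6 * ε * n)) with hβ
  have hβ0 : 0 ≤ β := by positivity
  have hsmall : (Fintype.card I : ℝ) ^ 3 * β ≤ Real.exp (-(ε * n)) := by
    have e1 : (Fintype.card I : ℝ) ^ 3 ≤ (2 * Real.exp (ε * n)) ^ 3 :=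
      pow_le_pow_left₀ (by positivity) hI 3
    calc (Fintype.card I : ℝ) ^ 3 * β ≤ (2 * Real.exp (ε * n)) ^ 3 * β :=
          mul_le_mul_of_nonneg_right e1 hβ0
      _ = 8 * C * Real.exp (-(ε * n)) * Real.exp (-(2 * ε * n)) := by
          have e2 : Real.exp (ε * n) ^ 3 * Real.exp (-(6 * ε * n))
              = Real.exp (-(ε * n)) * Real.exp (-(2 * ε * n)) := by
            rw [← Real.exp_nat_mul, ← Real.exp_add, ← Real.exp_add]
            congr 1; push_cast; ring
          rw [hβ, mul_pow]
          linear_combination 8 * C * e2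
      _ ≤ 1 * Real.exp (-(2 * ε * n)) :=
          mul_le_mul_of_nonneg_right hn1.le (Real.exp_pos _).le
      _ ≤ Real.exp (-(ε * n)) := by
          rw [one_mul]
          refine Real.exp_le_exp.2 ?_
          have : 0 ≤ ε * n := by positivity
          linarith
  have hlt : Fintype.card (Fin n → 𝒜) * ((Fintype.card I : ℝ) ^ 3 * β) ^ K < 1 := by
    calc Fintype.card (Fin n → 𝒜) * ((Fintype.card I : ℝ) ^ 3 * β) ^ K
        ≤ N ^ n * Real.exp (-(ε * n)) ^ K := by
          rw [Fintype.card_fun, Fintype.card_fin]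
          push_cast
          exact mul_le_mul_of_nonneg_left (pow_le_pow_left₀ (by positivity) hsmall K)
            (by positivity)
      _ = (N * Real.exp (-(ε * K))) ^ n := by
          rw [mul_pow, ← Real.exp_nat_mul, ← Real.exp_nat_mul]
          congr 2; ring
      _ < 1 := pow_lt_one₀ (by positivity) hK (by omega)
  obtain ⟨f, hf⟩ := exists_code_few_exceptional (I := I)
    (fun y v w => Finset.univ.filter fun x : Fin n → 𝒜 => IsExceptional δ y v w x)
    (β := β) (fun y v w => by
      refine (card_isExceptional_le hδ0.le hδ y v w).trans (le_of_eq ?_)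
      have : δ ^ 2 / 4 * n = 6 * ε * n := by rw [hε]; ring
      rw [hβ, this]; ring) K hlt
  refine ⟨f, fun y => ?_⟩
  obtain ⟨T, hT, h⟩ := hf y
  exact ⟨T, hT, fun i hi j k hj hk => by simpa using h i hi j k hj hk⟩

end Codebook

section Decoding

variable {𝒜 𝒵 : Type*} [Fintype 𝒜] [Fintype 𝒵] {n : ℕ}

/-- The output `z` looks as if the honest codeword `x`, jointly uniform with `(v, w)`, had been
sent against an adversary whose input depends on `(v, w)` only. -/
def IsExplained (U : Channel 𝒜 𝒜 𝒵) (δ : ℝ) (x v w : Fin n → 𝒜) (z : Fin n → 𝒵) : Prop :=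
  ∃ q : 𝒜 → 𝒜 → stdSimplex ℝ 𝒜, ∀ a b c d,
    |cnt (fun t => x t = a ∧ v t = b ∧ w t = c ∧ z t = d)
      - n * (Fintype.card 𝒜 : ℝ)⁻¹ ^ 3 * ∑ e, q b c e * U a e d| ≤ δ * n

open Classical in
/-- The channel noise in `z` deviates from its mean given the inputs `x` and `y`. -/
def IsNoisy (U : Channel 𝒜 𝒜 𝒵) (δ : ℝ) (x v w y : Fin n → 𝒜) (z : Fin n → 𝒵) : Prop :=
  ∃ a b c d, δ * n < |∑ t, if x t = a ∧ v t = b ∧ w t = c then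
    (if z t = d then 1 else 0) - U (x t) (y t) d else 0|

theorem isExplained_of_not_isNoisy [Nonempty 𝒜] {U : Channel 𝒜 𝒜 𝒵} {δ : ℝ}
    {x v w y : Fin n → 𝒜} {z : Fin n → 𝒵}
    (hx : ∀ a b c e, |cnt (fun t => x t = a ∧ v t = b ∧ w t = c ∧ y t = e)
      - (Fintype.card 𝒜 : ℝ)⁻¹ * cnt (fun t => v t = b ∧ w t = c ∧ y t = e)| ≤ δ * n)
    (hvw : ∀ b c, |cnt (fun t => v t = b ∧ w t = c) - n * (Fintype.card 𝒜 : ℝ)⁻¹ ^ 2|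
      ≤ 2 * δ * n)
    (hz : ¬ IsNoisy U δ x v w y z) :
    IsExplained U ((Fintype.card 𝒜 + 3) * δ) x v w z := by
  classical
  have hN : (1 : ℝ) ≤ Fintype.card 𝒜 := by exact_mod_cast Fintype.card_pos
  set N : ℝ := (Fintype.card 𝒜 : ℝ)
  unfold IsNoisy at hz
  push Not at hz
  choose q hq using fun b c => exists_conditional (fun t => v t = b ∧ w t = c) y
  refine ⟨q, fun a b c d => ?_⟩
  have h1 : |cnt (fun t => x t = a ∧ v t = b ∧ w t = c ∧ z t = d)
      - ∑ e, cnt (fun t => x t = a ∧ v t = b ∧ w t = c ∧ y t = e) * U a e d| ≤ δ * n := by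
    refine le_trans (le_of_eq ?_) (hz a b c d)
    congr 1
    have e1 := sum_cnt_mul (fun t => x t = a ∧ v t = b ∧ w t = c) y (fun e => U a e d)
    simp only [and_assoc] at e1
    rw [e1]
    unfold cnt
    rw [← sum_sub_distrib]
    refine sum_congr rfl fun t _ => ?_
    by_cases ha : x t = a
    · by_cases hp : v t = b ∧ w t = c
      · simp [ha, hp.1, hp.2]
      · have : ¬ (v t = b ∧ w t = c ∧ z t = d) := fun h => hp ⟨h.1, h.2.1⟩
        simp [hp, this]
    · simp [ha]
  have h2 : |∑ e, cnt (fun t => x t = a ∧ v t = b ∧ w t = c ∧ y t = e) * U a e d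
      - N⁻¹ * cnt (fun t => v t = b ∧ w t = c) * ∑ e, q b c e * U a e d| ≤ N * (δ * n) := by
    have e2 : ∑ e, cnt (fun t => x t = a ∧ v t = b ∧ w t = c ∧ y t = e) * U a e d
      - N⁻¹ * cnt (fun t => v t = b ∧ w t = c) * ∑ e, q b c e * U a e d
      = ∑ e, (cnt (fun t => x t = a ∧ v t = b ∧ w t = c ∧ y t = e)
        - N⁻¹ * cnt (fun t => v t = b ∧ w t = c ∧ y t = e)) * U a e d := by
      rw [mul_sum, ← sum_sub_distrib]
      refine sum_congr rfl fun e _ => ?_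
      have := hq b c e
      simp only [and_assoc] at this
      rw [this]; ring
    rw [e2]
    refine (abs_sum_le_sum_abs _ _).trans ((sum_le_sum fun e _ => ?_).trans
      (le_of_eq (by rw [sum_const, card_univ, nsmul_eq_mul])))
    rw [abs_mul, abs_of_nonneg (simplex_nonneg _ _)]
    exact (mul_le_of_le_one_right (abs_nonneg _) (simplex_le_one _ _)).trans (hx a b c e)
  have hq0 : 0 ≤ ∑ e, q b c e * U a e d :=
    sum_nonneg fun e _ => mul_nonneg (simplex_nonneg _ _) (simplex_nonneg _ _)
  have hq1 : ∑ e, q b c e * U a e d ≤ 1 :=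
    (sum_le_sum fun e _ => mul_le_of_le_one_right (simplex_nonneg _ _)
      (simplex_le_one _ _)).trans (simplex_sum _).le
  have h3 : |N⁻¹ * cnt (fun t => v t = b ∧ w t = c) * ∑ e, q b c e * U a e d
      - n * N⁻¹ ^ 3 * ∑ e, q b c e * U a e d| ≤ 2 * δ * n := by
    have e3 : N⁻¹ * cnt (fun t => v t = b ∧ w t = c) * ∑ e, q b c e * U a e d
      - n * N⁻¹ ^ 3 * ∑ e, q b c e * U a e d
      = (cnt (fun t => v t = b ∧ w t = c) - n * N⁻¹ ^ 2) * (N⁻¹ * ∑ e, q b c e * U a e d) := by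
      ring
    rw [e3, abs_mul]
    refine (mul_le_of_le_one_right (abs_nonneg _) ?_).trans (hvw b c)
    rw [abs_of_nonneg (by positivity)]
    exact mul_le_one₀ (inv_le_one_of_one_le₀ hN) hq0 hq1
  have h4 := (abs_sub_le _ _ _).trans (add_le_add ((abs_sub_le _ _ _).trans (add_le_add h1 h2)) h3)
  refine h4.trans (le_of_eq ?_)
  ring

theorem prodProb_isNoisy_le (U : Channel 𝒜 𝒜 𝒵) {δ : ℝ} (hδ0 : 0 ≤ δ) (hδ : δ ≤ 2)
    (x v w y : Fin n → 𝒜) :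
    U.prodProb {z | IsNoisy U δ x v w y z} x y
      ≤ Fintype.card (𝒜 × 𝒜 × 𝒜 × 𝒵) * (2 * Real.exp (-(δ ^ 2 / 4 * n))) := by
  classical
  rw [Channel.prodProb_eq_seqProb]
  have hp : ∀ t d, 0 ≤ U (x t) (y t) d := fun t d => simplex_nonneg _ _
  have hset : {z | IsNoisy U δ x v w y z} = ⋃ s : 𝒜 × 𝒜 × 𝒜 × 𝒵, {z : Fin n → 𝒵 |
      δ * n < |∑ t, if x t = s.1 ∧ v t = s.2.1 ∧ w t = s.2.2.1 then
        (if z t = s.2.2.2 then 1 else 0) - U (x t) (y t) s.2.2.2 else 0|} := by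
    ext z; simp [IsNoisy]
  rw [hset]
  refine seqProb_iUnion_le_of_le hp _ fun s => ?_
  have key := seqProb_hoeffding (ι := Fin n) (p := fun t => (U (x t) (y t) : 𝒵 → ℝ))
    (g := fun t z => if x t = s.1 ∧ v t = s.2.1 ∧ w t = s.2.2.1 then
        (if z = s.2.2.2 then 1 else 0) - U (x t) (y t) s.2.2.2 else 0)
    hp (fun t => simplex_sum _) (fun t d => ?_) (fun t => ?_) hδ0 hδ
  · simpa only [Fintype.card_fin] using key
  · have h0 := hp t s.2.2.2
    have h1 := simplex_le_one (U (x t) (y t)) s.2.2.2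
    rw [abs_le]
    split_ifs <;> constructor <;> linarith
  · split_ifs
    · simp [mul_sub, ← sum_mul]
    · simp

/-- Message `i` is accepted: it is regular and explains the output jointly with every pair of
other regular messages. -/
def Accepts (U : Channel 𝒜 𝒜 𝒵) {I : Type*} (f : I → Fin n → 𝒜) (G : Set I) (δ : ℝ) (i : I)
    (z : Fin n → 𝒵) : Prop :=
  i ∈ G ∧ ∀ j ∈ G, ∀ k ∈ G, j ≠ i → k ≠ i → j ≠ k → IsExplained U δ (f i) (f j) (f k) z

theorem prodProb_not_accepts_le [Nonempty 𝒜] (U : Channel 𝒜 𝒜 𝒵) {I : Type*} [Fintype I]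
    (f : I → Fin n → 𝒜) {δ : ℝ} (hδ0 : 0 ≤ δ) (hδ : δ ≤ 2) {y₀ : Fin n → 𝒜} {G : Set I}
    (hG : ∀ i ∈ G, ∀ j k, j ≠ i → k ≠ i → ¬ IsExceptional δ y₀ (f j) (f k) (f i))
    {i : I} (hi : i ∈ G) {y : Fin n → 𝒜}
    (hy : ∀ j k, j ≠ i → k ≠ i → ¬ IsExceptional δ y (f j) (f k) (f i)) :
    U.prodProb {z | ¬ Accepts U f G ((Fintype.card 𝒜 + 3) * δ) i z} (f i) y
      ≤ (Fintype.card I : ℝ) ^ 2 *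
        (Fintype.card (𝒜 × 𝒜 × 𝒜 × 𝒵) * (2 * Real.exp (-(δ ^ 2 / 4 * n)))) := by
  have hp : ∀ t d, 0 ≤ U (f i t) (y t) d := fun t d => simplex_nonneg _ _
  have hsub : {z | ¬ Accepts U f G ((Fintype.card 𝒜 + 3) * δ) i z}
      ⊆ ⋃ s : I × I, {z | IsNoisy U δ (f i) (f s.1) (f s.2) y z} := by
    intro z hz
    by_contra hcon
    simp only [Set.mem_iUnion, Set.mem_ofPred_eq, not_exists] at hcon
    refine hz ⟨hi, fun j hj k hk hji hki hjk => ?_⟩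
    refine isExplained_of_not_isNoisy (y := y) (fun a b c e => ?_) (fun b c => ?_)
      (hcon (j, k))
    · exact abs_cnt_sub_le_of_not_isExceptional (hy j k hji hki) a
        fun b' c' e' => b' = b ∧ c' = c ∧ e' = e
    · exact abs_cnt_pair_sub_le (hG j hj k k hjk.symm hjk.symm) (hG k hk j j hjk hjk) b c
  have hb : ∀ s : I × I, seqProb (fun t => (U (f i t) (y t) : 𝒵 → ℝ))
      {z | IsNoisy U δ (f i) (f s.1) (f s.2) y z}
      ≤ Fintype.card (𝒜 × 𝒜 × 𝒜 × 𝒵) * (2 * Real.exp (-(δ ^ 2 / 4 * n))) := fun s => by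
    rw [← Channel.prodProb_eq_seqProb]
    exact prodProb_isNoisy_le U hδ0 hδ (f i) (f s.1) (f s.2) y
  have h := (seqProb_mono hp hsub).trans (seqProb_iUnion_le_of_le hp _ hb)
  rw [← Channel.prodProb_eq_seqProb, Fintype.card_prod I I, Nat.cast_mul, ← sq] at h
  exact h

theorem average_not_accepts_le [Nonempty 𝒜] (U : Channel 𝒜 𝒜 𝒵) {I : Type*} [Fintype I]
    (f : I → Fin n → 𝒜) {δ : ℝ} (hδ0 : 0 ≤ δ) (hδ : δ ≤ 2) {M : ℕ}
    (hf : ∀ y, ∃ T : Finset I, #T ≤ M ∧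
        ∀ i ∉ T, ∀ j k, j ≠ i → k ≠ i → ¬ IsExceptional δ y (f j) (f k) (f i))
    {y₀ : Fin n → 𝒜} {T₀ : Finset I} (hT₀ : #T₀ ≤ M)
    (hG : ∀ i ∉ T₀, ∀ j k, j ≠ i → k ≠ i → ¬ IsExceptional δ y₀ (f j) (f k) (f i))
    {N : ℕ} (hN : 0 < N) (φ : Fin N → I) (hφ : Function.Injective φ) (y : Fin n → 𝒜) :
    (1 / (N : ℝ)) * ∑ m, U.prodProb
        {z | ¬ Accepts U f {i | i ∉ T₀} ((Fintype.card 𝒜 + 3) * δ) (φ m) z} (f (φ m)) y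
      ≤ 2 * M / N + (Fintype.card I : ℝ) ^ 2 *
        (Fintype.card (𝒜 × 𝒜 × 𝒜 × 𝒵) * (2 * Real.exp (-(δ ^ 2 / 4 * n)))) := by
  classical
  obtain ⟨T, hT, hTy⟩ := hf y
  set E := (Fintype.card I : ℝ) ^ 2 *
        (Fintype.card (𝒜 × 𝒜 × 𝒜 × 𝒵) * (2 * Real.exp (-(δ ^ 2 / 4 * n))))
  have hE : 0 ≤ E := by positivity
  have hN' : (0 : ℝ) < N := by exact_mod_cast hN
  have h1 : ∀ m, U.prodProb
        {z | ¬ Accepts U f {i | i ∉ T₀} ((Fintype.card 𝒜 + 3) * δ) (φ m) z} (f (φ m)) y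
        ≤ (if φ m ∈ T₀ ∪ T then 1 else 0) + E := by
    intro m
    split_ifs with h
    · refine le_add_of_le_of_nonneg ?_ hE
      exact seqProb_le_one (fun t d => simplex_nonneg _ _) (fun t => simplex_sum _) _
    · rw [zero_add]
      simp only [mem_union, not_or] at h
      exact prodProb_not_accepts_le U f hδ0 hδ hG h.1 (hTy _ h.2)
  have h2 : ∑ m, (if φ m ∈ T₀ ∪ T then (1 : ℝ) else 0) ≤ 2 * M := by
    rw [sum_boole]
    have a : #{m | φ m ∈ T₀ ∪ T} ≤ #(T₀ ∪ T) :=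
      card_le_card_of_injOn φ (fun m hm => by simpa using hm) hφ.injOn
    have b := card_union_le T₀ T
    have : #{m | φ m ∈ T₀ ∪ T} ≤ 2 * M := by omega
    exact_mod_cast this
  rw [one_div, inv_mul_le_iff₀ hN']
  refine (sum_le_sum fun m _ => h1 m).trans ?_
  rw [sum_add_distrib, sum_const, card_univ, Fintype.card_fin, nsmul_eq_mul, mul_add,
    mul_div_cancel₀ _ hN'.ne']
  linarith

end Decoding

section Separation

theorem continuous_simplex_apply {α β : Type*} [Fintype α] [TopologicalSpace β]
    {p : β → stdSimplex ℝ α} (hp : Continuous p) (a : α) : Continuous fun b => (p b) a :=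
  (continuous_apply a).comp (continuous_subtype_val.comp hp)

variable {𝒳 𝒴 𝒵 : Type*} [Fintype 𝒳] [Fintype 𝒴] [Fintype 𝒵]

theorem compactSpace_stdSimplex (α : Type*) [Fintype α] : CompactSpace (stdSimplex ℝ α) :=
  isCompact_iff_compactSpace.1 (isCompact_stdSimplex ℝ α)

/-- The midpoint of two probability vectors. -/
noncomputable def simplexMid {α : Type*} [Fintype α] (p q : stdSimplex ℝ α) : stdSimplex ℝ α :=
  ⟨fun a => (p a + q a) / 2,
    fun a => by have := simplex_nonneg p a; have := simplex_nonneg q a; positivity,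
    by rw [← sum_div, sum_add_distrib, simplex_sum, simplex_sum]; norm_num⟩

theorem sum_simplexMid_mul {α : Type*} [Fintype α] (p q : stdSimplex ℝ α) (u : α → ℝ) :
    ∑ a, simplexMid p q a * u a = (∑ a, p a * u a + ∑ a, q a * u a) / 2 := by
  rw [← sum_add_distrib, sum_div]
  refine sum_congr rfl fun a _ => ?_
  change (p a + q a) / 2 * u a = _
  ring

theorem isASpoofable_of_eq (W : Channel 𝒳 𝒴 𝒵) (q₁ q₂ : 𝒳 → 𝒴 → stdSimplex ℝ 𝒴)
    (q₃ : 𝒳 → 𝒳 → stdSimplex ℝ 𝒳)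
    (h₁ : ∀ a b c d, ∑ y, q₁ b c y * W a y d = ∑ x, q₃ b a x * W x c d)
    (h₂ : ∀ a b c d, ∑ y, q₂ a c y * W b y d = ∑ x, q₃ b a x * W x c d) : IsASpoofable W := by
  refine ⟨fun a c => simplexMid (q₁ a c) (q₂ a c), fun b a => simplexMid (q₃ b a) (q₃ a b),
    fun a b c d => ?_⟩
  simp only [sum_simplexMid_mul]
  have e1 := h₁ a b c d
  have e2 := h₂ a b c d
  have e3 := h₁ b a c d
  have e4 := h₂ b a c d
  constructor <;> linarith

/-- Triples of conditional distributions that describe two attacks of user B and one of user A. -/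
abbrev Attacks (𝒳 𝒴 : Type*) [Fintype 𝒳] [Fintype 𝒴] :=
  (𝒳 → 𝒴 → stdSimplex ℝ 𝒴) × (𝒳 → 𝒴 → stdSimplex ℝ 𝒴) × (𝒳 → 𝒳 → stdSimplex ℝ 𝒳)

/-- For a channel that is not A-spoofable, three attacks cannot be nearly indistinguishable. -/
theorem exists_separation {W : Channel 𝒳 𝒴 𝒵} (hW : ¬ IsASpoofable W) :
    ∃ η > 0, ∀ (q₁ q₂ : 𝒳 → 𝒴 → stdSimplex ℝ 𝒴) (q₃ : 𝒳 → 𝒳 → stdSimplex ℝ 𝒳),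
      ¬ ∀ a b c d, |∑ y, q₁ b c y * W a y d - ∑ x, q₃ b a x * W x c d| ≤ η ∧
        |∑ y, q₂ a c y * W b y d - ∑ x, q₃ b a x * W x c d| ≤ η := by
  have := compactSpace_stdSimplex 𝒳
  have := compactSpace_stdSimplex 𝒴
  let F : Attacks 𝒳 𝒴 → ℝ := fun q => ∑ s : 𝒳 × 𝒳 × 𝒴 × 𝒵,
    (|∑ y, q.1 s.2.1 s.2.2.1 y * W s.1 y s.2.2.2
        - ∑ x, q.2.2 s.2.1 s.1 x * W x s.2.2.1 s.2.2.2|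
      + |∑ y, q.2.1 s.1 s.2.2.1 y * W s.2.1 y s.2.2.2
        - ∑ x, q.2.2 s.2.1 s.1 x * W x s.2.2.1 s.2.2.2|)
  have h₁ : ∀ a b c, Continuous fun q : Attacks 𝒳 𝒴 => q.1 a b c := fun a b c =>
    continuous_simplex_apply (by fun_prop) c
  have h₂ : ∀ a b c, Continuous fun q : Attacks 𝒳 𝒴 => q.2.1 a b c := fun a b c =>
    continuous_simplex_apply (by fun_prop) c
  have h₃ : ∀ a b c, Continuous fun q : Attacks 𝒳 𝒴 => q.2.2 a b c := fun a b c =>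
    continuous_simplex_apply (by fun_prop) c
  have hF : Continuous F := by
    refine continuous_finsetSum _ fun s _ => Continuous.add
      (Continuous.abs (Continuous.sub ?_ ?_)) (Continuous.abs (Continuous.sub ?_ ?_)) <;>
    refine continuous_finsetSum _ fun _ _ => Continuous.mul ?_ continuous_const
    exacts [h₁ _ _ _, h₃ _ _ _, h₂ _ _ _, h₃ _ _ _]
  rcases isEmpty_or_nonempty (Attacks 𝒳 𝒴) with hΩ | hΩ
  · exact ⟨1, one_pos, fun q₁ q₂ q₃ => (hΩ.false (q₁, q₂, q₃)).elim⟩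
  obtain ⟨q, -, hq⟩ := isCompact_univ.exists_isMinOn Set.univ_nonempty hF.continuousOn
  have hpos : 0 < F q := by
    by_contra hle
    have hnn : ∀ s ∈ (univ : Finset (𝒳 × 𝒳 × 𝒴 × 𝒵)), 0 ≤
      (|∑ y, q.1 s.2.1 s.2.2.1 y * W s.1 y s.2.2.2
        - ∑ x, q.2.2 s.2.1 s.1 x * W x s.2.2.1 s.2.2.2|
      + |∑ y, q.2.1 s.1 s.2.2.1 y * W s.2.1 y s.2.2.2
        - ∑ x, q.2.2 s.2.1 s.1 x * W x s.2.2.1 s.2.2.2|) := fun s _ => by positivity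
    have h0 := (sum_eq_zero_iff_of_nonneg hnn).1 (le_antisymm (not_lt.1 hle) (sum_nonneg hnn))
    refine hW (isASpoofable_of_eq W q.1 q.2.1 q.2.2 (fun a b c d => ?_) fun a b c d => ?_) <;>
    · have h := h0 (a, b, c, d) (mem_univ _)
      rw [add_eq_zero_iff_of_nonneg (abs_nonneg _) (abs_nonneg _), abs_eq_zero, abs_eq_zero,
        sub_eq_zero, sub_eq_zero] at h
      first | exact h.1 | exact h.2
  set m : ℝ := (Fintype.card (𝒳 × 𝒳 × 𝒴 × 𝒵) : ℝ)
  have hm : 0 ≤ m := Nat.cast_nonneg _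
  refine ⟨F q / (2 * m + 1), by positivity, fun q₁ q₂ q₃ hcon => ?_⟩
  have h1 : F q ≤ F (q₁, q₂, q₃) := hq (Set.mem_univ _)
  have h2 : F (q₁, q₂, q₃) ≤ m * (F q / (2 * m + 1) + F q / (2 * m + 1)) := by
    refine (sum_le_sum fun s _ => add_le_add (hcon s.1 s.2.1 s.2.2.1 s.2.2.2).1
      (hcon s.1 s.2.1 s.2.2.1 s.2.2.2).2).trans (le_of_eq ?_)
    rw [sum_const, card_univ, nsmul_eq_mul]
  have h3 : m * (F q / (2 * m + 1) + F q / (2 * m + 1)) < F q := by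
    have : m * (F q / (2 * m + 1) + F q / (2 * m + 1)) = F q - F q / (2 * m + 1) := by
      field_simp; ring
    rw [this]
    have : 0 < F q / (2 * m + 1) := by positivity
    linarith
  linarith

end Separation

section Decoder

variable {𝒜 𝒵 : Type*} [Fintype 𝒜] [Fintype 𝒵] {n : ℕ}

/-- Two messages of one user and a message of the other user are never all accepted. -/
theorem not_accepts_three [Nonempty 𝒜] {U : Channel 𝒜 𝒜 𝒵} {η : ℝ}
    (hU : ∀ q₁ q₂ q₃ : 𝒜 → 𝒜 → stdSimplex ℝ 𝒜,
      ¬ ∀ a b c d, |∑ y, q₁ b c y * U a y d - ∑ x, q₃ b a x * U x c d| ≤ η ∧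
        |∑ y, q₂ a c y * U b y d - ∑ x, q₃ b a x * U x c d| ≤ η)
    {δ : ℝ} (hδ : 2 * δ ≤ (Fintype.card 𝒜 : ℝ)⁻¹ ^ 3 * η) (hn : 0 < n)
    {I : Type*} {f : I → Fin n → 𝒜} {G : Set I} {z : Fin n → 𝒵} {i j k : I}
    (hij : i ≠ j) (hik : i ≠ k) (hjk : j ≠ k) (hi : Accepts U f G δ i z)
    (hj : Accepts U f G δ j z) (hk : Accepts U.swap f G δ k z) : False := by
  have hN : (0 : ℝ) < Fintype.card 𝒜 := by exact_mod_cast Fintype.card_pos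
  have hn' : (0 : ℝ) < n := by exact_mod_cast hn
  obtain ⟨q₁, h₁⟩ := hi.2 j hj.1 k hk.1 hij.symm hik.symm hjk
  obtain ⟨q₂, h₂⟩ := hj.2 i hi.1 k hk.1 hij hjk.symm hik
  obtain ⟨q₃, h₃⟩ := hk.2 j hj.1 i hi.1 hjk hik hij.symm
  refine hU q₁ q₂ q₃ fun a b c d => ?_
  have e₁ := h₁ a b c d
  have e₂ := h₂ b a c d
  have e₃ := h₃ c b a d
  have p₂ : cnt (fun t => f j t = b ∧ f i t = a ∧ f k t = c ∧ z t = d)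
      = cnt (fun t => f i t = a ∧ f j t = b ∧ f k t = c ∧ z t = d) := by
    congr 1; funext t; simp only [eq_iff_iff]; tauto
  have p₃ : cnt (fun t => f k t = c ∧ f j t = b ∧ f i t = a ∧ z t = d)
      = cnt (fun t => f i t = a ∧ f j t = b ∧ f k t = c ∧ z t = d) := by
    congr 1; funext t; simp only [eq_iff_iff]; tauto
  rw [p₂] at e₂
  rw [p₃] at e₃
  set κ : ℝ := (Fintype.card 𝒜 : ℝ)⁻¹ ^ 3
  have hκ : 0 < κ := by positivity
  set r := cnt (fun t => f i t = a ∧ f j t = b ∧ f k t = c ∧ z t = d)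
  have key : ∀ s s' : ℝ, |r - n * κ * s| ≤ δ * n → |r - n * κ * s'| ≤ δ * n → |s - s'| ≤ η := by
    intro s s' hs hs'
    rw [abs_sub_comm] at hs
    have h := (abs_sub_le _ _ _).trans (add_le_add hs hs')
    rw [← mul_sub, abs_mul, abs_of_pos (by positivity)] at h
    refine le_of_mul_le_mul_left (h.trans ?_) (by positivity : 0 < n * κ)
    nlinarith
  exact ⟨key _ _ e₁ e₃, key _ _ e₂ e₃⟩

open Classical in
/-- The decoder that outputs the accepted messages and blames a user without any. -/
noncomputable def acceptDecoder {NA NB : ℕ} (A : Fin NA → (Fin n → 𝒵) → Prop)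
    (B : Fin NB → (Fin n → 𝒵) → Prop) (z : Fin n → 𝒵) : DecoderOutput NA NB :=
  if hA : ∃ i, A i z then
    if hB : ∃ k, B k z then .messages hA.choose hB.choose else .blameB
  else .blameA

end Decoder

section AcceptDecoder

variable {𝒜 𝒵 : Type*} {n NA NB : ℕ} {A : Fin NA → (Fin n → 𝒵) → Prop} {B : Fin NB → (Fin n → 𝒵) → Prop}

theorem acceptDecoder_forA (hA : ∀ i j k z, A i z → A j z → B k z → i = j) {i : Fin NA}
    {z : Fin n → 𝒵} (hi : A i z) :
    (acceptDecoder A B z).forA = .message i ∨ (acceptDecoder A B z).forA = .blameB := by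
  have h : ∃ i, A i z := ⟨i, hi⟩
  unfold acceptDecoder
  rw [dif_pos h]
  split_ifs with hB
  · rw [hA i _ _ z hi h.choose_spec hB.choose_spec]
    exact Or.inl rfl
  · exact Or.inr rfl

theorem acceptDecoder_forB (hB : ∀ i j k z, B i z → B j z → A k z → i = j) {k : Fin NB}
    {z : Fin n → 𝒵} (hk : B k z) :
    (acceptDecoder A B z).forB = .message k ∨ (acceptDecoder A B z).forB = .blameA := by
  have h : ∃ i, B i z := ⟨k, hk⟩
  unfold acceptDecoder
  split_ifs with hA
  · rw [hB k _ _ z hk h.choose_spec hA.choose_spec]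
    exact Or.inl rfl
  · exact Or.inr rfl

theorem acceptDecoder_eq (hA : ∀ i j k z, A i z → A j z → B k z → i = j)
    (hB : ∀ i j k z, B i z → B j z → A k z → i = j) {i : Fin NA} {k : Fin NB}
    {z : Fin n → 𝒵} (hi : A i z) (hk : B k z) : acceptDecoder A B z = .messages i k := by
  have h : ∃ i, A i z := ⟨i, hi⟩
  have h' : ∃ i, B i z := ⟨k, hk⟩
  unfold acceptDecoder
  rw [dif_pos h, dif_pos h', hA i _ _ z hi h.choose_spec hk, hB k _ _ z hk h'.choose_spec hi]

theorem pe_le_of_accepts [Fintype 𝒜] [Fintype 𝒵] [Nonempty 𝒜] (W : Channel 𝒜 𝒜 𝒵) (c : Code 𝒜 𝒜 𝒵 NA NB n)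
    (hc : c.dec = acceptDecoder A B)
    (hA : ∀ i j k z, A i z → A j z → B k z → i = j)
    (hB : ∀ i j k z, B i z → B j z → A k z → i = j) (hNA : 0 < NA) (hNB : 0 < NB) {eA eB : ℝ}
    (hA' : ∀ y, (1 / (NA : ℝ)) * ∑ i, W.prodProb {z | ¬ A i z} (c.encA i) y ≤ eA)
    (hB' : ∀ x, (1 / (NB : ℝ)) * ∑ k, W.prodProb {z | ¬ B k z} x (c.encB k) ≤ eB) :
    c.pe W ≤ eA + eB := by
  have hNA' : (0 : ℝ) < NA := by exact_mod_cast hNA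
  have hNB' : (0 : ℝ) < NB := by exact_mod_cast hNB
  obtain ⟨a₀⟩ := ‹Nonempty 𝒜›
  have heA : 0 ≤ eA := le_trans (mul_nonneg (by positivity)
    (sum_nonneg fun i _ => W.prodProb_nonneg _ _ _)) (hA' fun _ => a₀)
  have heB : 0 ≤ eB := le_trans (mul_nonneg (by positivity)
    (sum_nonneg fun i _ => W.prodProb_nonneg _ _ _)) (hB' fun _ => a₀)
  have hsubA : ∀ i, c.errA i ⊆ {z | ¬ A i z} := fun i z hz hi => by
    have hz' : (c.dec z).forA ≠ .message i ∧ (c.dec z).forA ≠ .blameB := hz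
    rw [hc] at hz'
    rcases acceptDecoder_forA hA hi with h | h
    · exact hz'.1 h
    · exact hz'.2 h
  have hsubB : ∀ k, c.errB k ⊆ {z | ¬ B k z} := fun k z hz hk => by
    have hz' : (c.dec z).forB ≠ .message k ∧ (c.dec z).forB ≠ .blameA := hz
    rw [hc] at hz'
    rcases acceptDecoder_forB hB hk with h | h
    · exact hz'.1 h
    · exact hz'.2 h
  have hsubH : ∀ i k, c.errHon i k ⊆ {z | ¬ A i z} ∪ {z | ¬ B k z} := fun i k z hz => by
    have hz' : c.dec z ≠ .messages i k := hz
    by_contra hcon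
    simp only [Set.mem_union, Set.mem_ofPred_eq, not_or, not_not] at hcon
    exact hz' (hc ▸ acceptDecoder_eq hA hB hcon.1 hcon.2)
  have : Nonempty (Fin n → 𝒜) := ⟨fun _ => a₀⟩
  refine max_le ?_ (max_le (ciSup_le fun x => ?_) (ciSup_le fun y => ?_))
  · have hA2 : ∀ y, ∑ i, W.prodProb {z | ¬ A i z} (c.encA i) y ≤ NA * eA := fun y => by
      have := hA' y
      rwa [one_div, inv_mul_le_iff₀ hNA'] at this
    have hB2 : ∀ x, ∑ k, W.prodProb {z | ¬ B k z} x (c.encB k) ≤ NB * eB := fun x => by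
      have := hB' x
      rwa [one_div, inv_mul_le_iff₀ hNB'] at this
    unfold Code.peHon
    rw [one_div, inv_mul_le_iff₀ (by positivity)]
    have h1 : ∑ i, ∑ k, W.prodProb (c.errHon i k) (c.encA i) (c.encB k)
        ≤ ∑ i, ∑ k, (W.prodProb {z | ¬ A i z} (c.encA i) (c.encB k)
          + W.prodProb {z | ¬ B k z} (c.encA i) (c.encB k)) :=
      sum_le_sum fun i _ => sum_le_sum fun k _ => (W.prodProb_mono _ _ (hsubH i k)).trans
        (W.prodProb_union_le _ _ _ _)
    have h2 : ∑ i, ∑ k, W.prodProb {z | ¬ A i z} (c.encA i) (c.encB k) ≤ NB * (NA * eA) := by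
      rw [sum_comm]
      refine (sum_le_sum fun k _ => hA2 (c.encB k)).trans (le_of_eq ?_)
      simp
    have h3 : ∑ i, ∑ k, W.prodProb {z | ¬ B k z} (c.encA i) (c.encB k) ≤ NA * (NB * eB) := by
      refine (sum_le_sum fun i _ => hB2 (c.encA i)).trans (le_of_eq ?_)
      simp
    simp only [sum_add_distrib] at h1
    linarith
  · refine le_trans (mul_le_mul_of_nonneg_left (sum_le_sum fun k _ => W.prodProb_mono _ _ (hsubB k))
      (by positivity)) ((hB' x).trans (by linarith))
  · refine le_trans (mul_le_mul_of_nonneg_left (sum_le_sum fun i _ => W.prodProb_mono _ _ (hsubA i))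
      (by positivity)) ((hA' y).trans (by linarith))

end AcceptDecoder

/-- Codes of small positive rate for a channel that is not spoofable. -/
theorem exists_code_pe_le {𝒜 𝒵 : Type*} [Fintype 𝒜] [Fintype 𝒵] [Nonempty 𝒜]
    {W : Channel 𝒜 𝒜 𝒵} (hW : ¬ IsSpoofable W) :
    ∃ ε > 0, ∃ (M C : ℝ) (n₀ : ℕ), ∀ n ≥ n₀, ∀ NA NB : ℕ, 0 < NA → 0 < NB →
      (NA : ℝ) ≤ Real.exp (ε * n) → (NB : ℝ) ≤ Real.exp (ε * n) →
      ∃ c : Code 𝒜 𝒜 𝒵 NA NB n,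
        c.pe W ≤ M / NA + M / NB + C * Real.exp (-(ε * n)) := by
  classical
  have hN : (1 : ℝ) ≤ Fintype.card 𝒜 := by exact_mod_cast Fintype.card_pos
  set N : ℝ := (Fintype.card 𝒜 : ℝ) with hNdef
  obtain ⟨η₁, hη₁, h₁⟩ := exists_separation fun h => hW (Or.inl h)
  obtain ⟨η₂, hη₂, h₂⟩ := exists_separation (W := W.swap) fun h =>
    hW (Or.inr ((isASpoofable_swap_iff W).1 h))
  set η := min (min η₁ η₂) 1
  have hη : 0 < η := by positivity
  have hηη₁ : η ≤ η₁ := (min_le_left _ _).trans (min_le_left _ _)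
  have hηη₂ : η ≤ η₂ := (min_le_left _ _).trans (min_le_right _ _)
  have hη1 : η ≤ 1 := min_le_right _ _
  have hκ : N⁻¹ ^ 3 ≤ 1 := pow_le_one₀ (by positivity) (inv_le_one_of_one_le₀ hN)
  set δ' : ℝ := N⁻¹ ^ 3 * η / 2 with hδ'
  set δ : ℝ := δ' / (N + 3) with hδdef
  have hδ'0 : 0 < δ' := by positivity
  have hδ0 : 0 < δ := by positivity
  have hδ'1 : δ' ≤ 2 := by
    have := mul_le_one₀ hκ hη.le hη1
    rw [hδ']; linarith
  have hδ : δ ≤ 2 := (div_le_self hδ'0.le (by linarith)).trans hδ'1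
  have hδδ' : (N + 3) * δ = δ' := mul_div_cancel₀ _ (by positivity)
  obtain ⟨M, n₀, hcb⟩ := exists_codebook 𝒜 hδ0 hδ
  set ε := δ ^ 2 / 24 with hε
  set D : ℝ := Fintype.card (𝒜 × 𝒜 × 𝒜 × 𝒵) * 2
  have hD : 0 ≤ D := by positivity
  refine ⟨ε, by positivity, 2 * M, 8 * D, max n₀ 1, fun n hn NA NB hNA hNB hA hB => ?_⟩
  have hn1 : 0 < n := lt_of_lt_of_le one_pos ((le_max_right _ _).trans hn)
  have hI : (Fintype.card (Fin NA ⊕ Fin NB) : ℝ) ≤ 2 * Real.exp (ε * n) := by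
    rw [Fintype.card_sum, Fintype.card_fin, Fintype.card_fin]
    push_cast
    linarith
  obtain ⟨f, hf⟩ := hcb n ((le_max_left _ _).trans hn) (Fin NA ⊕ Fin NB) hI
  obtain ⟨a₀⟩ := ‹Nonempty 𝒜›
  have : Nonempty 𝒜 := ⟨a₀⟩
  obtain ⟨T₀, hT₀, hG⟩ := hf fun _ => a₀
  have hE : (Fintype.card (Fin NA ⊕ Fin NB) : ℝ) ^ 2 *
      (Fintype.card (𝒜 × 𝒜 × 𝒜 × 𝒵) * (2 * Real.exp (-(δ ^ 2 / 4 * n))))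
      ≤ 4 * D * Real.exp (-(ε * n)) := by
    have h1 : (Fintype.card (Fin NA ⊕ Fin NB) : ℝ) ^ 2 ≤ (2 * Real.exp (ε * n)) ^ 2 :=
      pow_le_pow_left₀ (by positivity) hI 2
    refine (mul_le_mul_of_nonneg_right h1 (by positivity)).trans ?_
    have h2 : Real.exp (ε * n) ^ 2 * Real.exp (-(δ ^ 2 / 4 * n)) ≤ Real.exp (-(ε * n)) := by
      rw [← Real.exp_nat_mul, ← Real.exp_add]
      refine Real.exp_le_exp.2 ?_
      have h3 : δ ^ 2 / 4 * n = 6 * (ε * n) := by rw [hε]; ring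
      have h4 : 0 ≤ ε * n := by positivity
      rw [h3]
      push_cast
      linarith
    calc _ = 4 * D * (Real.exp (ε * n) ^ 2 * Real.exp (-(δ ^ 2 / 4 * n))) := by
          simp only [D]; ring
      _ ≤ _ := mul_le_mul_of_nonneg_left h2 (by positivity)
  set G : Set (Fin NA ⊕ Fin NB) := {i | i ∉ T₀}
  set A : Fin NA → (Fin n → 𝒵) → Prop := fun i z => Accepts W f G δ' (.inl i) z
  set B : Fin NB → (Fin n → 𝒵) → Prop := fun k z => Accepts W.swap f G δ' (.inr k) z
  have avgA := average_not_accepts_le W f hδ0.le hδ hf hT₀ hG hNA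
    (fun i : Fin NA => (Sum.inl i : Fin NA ⊕ Fin NB)) Sum.inl_injective
  have avgB := average_not_accepts_le W.swap f hδ0.le hδ hf hT₀ hG hNB
    (fun k : Fin NB => (Sum.inr k : Fin NA ⊕ Fin NB)) Sum.inr_injective
  rw [← hNdef, hδδ'] at avgA avgB
  have huA : ∀ i j k z, A i z → A j z → B k z → i = j := by
    intro i j k z hi hj hk
    by_contra hij
    refine not_accepts_three h₁ (δ := δ') ?_ hn1 (fun h => hij (Sum.inl_injective h))
      Sum.inl_ne_inr Sum.inl_ne_inr hi hj hk
    rw [hδ', mul_div_cancel₀ _ two_ne_zero]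
    exact mul_le_mul_of_nonneg_left hηη₁ (by positivity)
  have huB : ∀ i j k z, B i z → B j z → A k z → i = j := by
    intro i j k z hi hj hk
    by_contra hij
    refine not_accepts_three h₂ (δ := δ') ?_ hn1 (fun h => hij (Sum.inr_injective h))
      Sum.inr_ne_inl Sum.inr_ne_inl hi hj hk
    rw [hδ', mul_div_cancel₀ _ two_ne_zero]
    exact mul_le_mul_of_nonneg_left hηη₂ (by positivity)
  let c : Code 𝒜 𝒜 𝒵 NA NB n := ⟨fun i => f (.inl i), fun k => f (.inr k), acceptDecoder A B⟩
  refine ⟨c, (pe_le_of_accepts W c rfl huA huB hNA hNB (fun y => (avgA y).trans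
    (add_le_add le_rfl hE)) (fun x => (avgB x).trans (add_le_add le_rfl hE))).trans
    (le_of_eq ?_)⟩
  ring

section ErrorProbability

variable {𝒳 𝒴 𝒵 : Type*} [Fintype 𝒵] {NA NB n : ℕ}

theorem Code.average_errB_le_pe [Fintype 𝒳] (c : Code 𝒳 𝒴 𝒵 NA NB n) (W : Channel 𝒳 𝒴 𝒵) (x : Fin n → 𝒳) :
    (1 / (NB : ℝ)) * ∑ k, W.prodProb (c.errB k) x (c.encB k) ≤ c.pe W := by
  classical
  exact (le_ciSup (f := fun x => (1 / (NB : ℝ)) * ∑ k, W.prodProb (c.errB k) x (c.encB k))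
    (Set.finite_range _).bddAbove x).trans ((le_max_left _ _).trans (le_max_right _ _))

theorem Code.average_errA_le_pe [Fintype 𝒴] (c : Code 𝒳 𝒴 𝒵 NA NB n) (W : Channel 𝒳 𝒴 𝒵) (y : Fin n → 𝒴) :
    (1 / (NA : ℝ)) * ∑ i, W.prodProb (c.errA i) (c.encA i) y ≤ c.pe W := by
  classical
  exact (le_ciSup (f := fun y => (1 / (NA : ℝ)) * ∑ i, W.prodProb (c.errA i) (c.encA i) y)
    (Set.finite_range _).bddAbove y).trans ((le_max_right _ _).trans (le_max_right _ _))

theorem Code.pe_nonneg (c : Code 𝒳 𝒴 𝒵 NA NB n) (W : Channel 𝒳 𝒴 𝒵) : 0 ≤ c.pe W :=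
  le_trans (mul_nonneg (by positivity)
    (sum_nonneg fun i _ => sum_nonneg fun k _ => W.prodProb_nonneg _ _ _)) (le_max_left _ _)

end ErrorProbability

section Capacity

variable {𝒳 𝒴 𝒵 : Type*} [Fintype 𝒳] [Fintype 𝒴] [Fintype 𝒵]

/-- The channel with both input alphabets extended to `𝒳 × 𝒴`. -/
def Channel.extend (W : Channel 𝒳 𝒴 𝒵) : Channel (𝒳 × 𝒴) (𝒳 × 𝒴) 𝒵 := fun a b => W a.1 b.2

/-- The marginal distribution of a coordinate. -/
noncomputable def simplexMap {α β : Type*} [Fintype α] [Fintype β] (g : α → β)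
    (p : stdSimplex ℝ α) : stdSimplex ℝ β := by
  classical
  exact ⟨fun b => ∑ a with g a = b, p a, fun b => sum_nonneg fun a _ => simplex_nonneg p a,
    (sum_fiberwise univ g p).trans (simplex_sum p)⟩

theorem sum_simplexMap_mul {α β : Type*} [Fintype α] [Fintype β] (g : α → β)
    (p : stdSimplex ℝ α) (u : β → ℝ) :
    ∑ b, simplexMap g p b * u b = ∑ a, p a * u (g a) := by
  classical
  have h : ∀ b, simplexMap g p b * u b = ∑ a with g a = b, p a * u (g a) := by
    intro b
    change (∑ a with g a = b, p a) * u b = _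
    rw [sum_mul]
    exact sum_congr rfl fun a ha => by rw [(mem_filter.1 ha).2]
  simp only [h]
  exact sum_fiberwise univ g fun a => p a * u (g a)

theorem isASpoofable_of_extend [Nonempty 𝒳] [Nonempty 𝒴] {W : Channel 𝒳 𝒴 𝒵}
    (h : IsASpoofable W.extend) : IsASpoofable W := by
  obtain ⟨x₀⟩ := ‹Nonempty 𝒳›
  obtain ⟨y₀⟩ := ‹Nonempty 𝒴›
  obtain ⟨QY, QX, hQ⟩ := h
  refine ⟨fun x y => simplexMap Prod.snd (QY (x, y₀) (x₀, y)),
    fun x x' => simplexMap Prod.fst (QX (x, y₀) (x', y₀)), fun x' xt yt z => ?_⟩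
  have := hQ (x', y₀) (xt, y₀) (x₀, yt) z
  simp only [Channel.extend] at this
  rw [sum_simplexMap_mul _ _ fun y => W x' y z, sum_simplexMap_mul _ _ fun y => W xt y z,
    sum_simplexMap_mul _ _ fun x => W x yt z]
  exact this

theorem isBSpoofable_of_extend [Nonempty 𝒳] [Nonempty 𝒴] {W : Channel 𝒳 𝒴 𝒵}
    (h : IsBSpoofable W.extend) : IsBSpoofable W := by
  obtain ⟨x₀⟩ := ‹Nonempty 𝒳›
  obtain ⟨y₀⟩ := ‹Nonempty 𝒴›
  obtain ⟨QX, QY, hQ⟩ := h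
  refine ⟨fun x y => simplexMap Prod.fst (QX (x, y₀) (x₀, y)),
    fun y y' => simplexMap Prod.snd (QY (x₀, y) (x₀, y')), fun xt yt y' z => ?_⟩
  have := hQ (xt, y₀) (x₀, yt) (x₀, y') z
  simp only [Channel.extend] at this
  rw [sum_simplexMap_mul _ _ fun x => W x y' z, sum_simplexMap_mul _ _ fun x => W x yt z,
    sum_simplexMap_mul _ _ fun y => W xt y z]
  exact this

variable {NA NB n : ℕ}

theorem Code.one_sub_le_of_isASpoofable (c : Code 𝒳 𝒴 𝒵 NA NB n) {W : Channel 𝒳 𝒴 𝒵}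
    (hW : IsASpoofable W) (hNA : 0 < NA) (hNB : 0 < NB) : 1 - 1 / (NA : ℝ) ≤ 3 * c.pe W := by
  refine hW.card_le c.encA c.encB c.errA c.errB (fun i j k hij => ?_) (c.average_errA_le_pe W)
    (c.average_errB_le_pe W) hNA hNB
  refine Set.eq_univ_of_forall fun z => ?_
  simp only [Set.mem_union, Code.errA, Code.errB, Set.mem_ofPred_eq]
  cases c.dec z <;> simp [DecoderOutput.forA, DecoderOutput.forB]
  grind

theorem Code.one_sub_le_of_isBSpoofable (c : Code 𝒳 𝒴 𝒵 NA NB n) {W : Channel 𝒳 𝒴 𝒵}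
    (hW : IsBSpoofable W) (hNA : 0 < NA) (hNB : 0 < NB) : 1 - 1 / (NB : ℝ) ≤ 3 * c.pe W := by
  refine ((isASpoofable_swap_iff W).2 hW).card_le c.encB c.encA c.errB c.errA
    (fun i j k hij => ?_) (c.average_errB_le_pe W) (c.average_errA_le_pe W) hNB hNA
  refine Set.eq_univ_of_forall fun z => ?_
  simp only [Set.mem_union, Code.errA, Code.errB, Set.mem_ofPred_eq]
  cases c.dec z <;> simp [DecoderOutput.forA, DecoderOutput.forB]
  grind

theorem floor_two_rpow_pos {R : ℝ} (hR : 0 ≤ R) (n : ℕ) : 0 < ⌊(2 : ℝ) ^ ((n : ℝ) * R)⌋₊ :=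
  Nat.floor_pos.2 (Real.one_le_rpow one_le_two (by positivity))

theorem tendsto_floor_two_rpow {R : ℝ} (hR : 0 < R) :
    Filter.Tendsto (fun n : ℕ => (⌊(2 : ℝ) ^ ((n : ℝ) * R)⌋₊ : ℝ)) Filter.atTop Filter.atTop := by
  refine tendsto_natCast_atTop_atTop.comp (tendsto_nat_floor_atTop.comp ?_)
  have h : ∀ n : ℕ, (2 : ℝ) ^ ((n : ℝ) * R) = ((2 : ℝ) ^ R) ^ n := fun n => by
    rw [mul_comm, Real.rpow_mul_natCast zero_le_two]
  simp only [h]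
  exact tendsto_pow_atTop_atTop_of_one_lt (Real.one_lt_rpow one_lt_two hR)

theorem eq_zero_of_one_sub_le {R : ℝ} (hR : 0 ≤ R) {e : ℕ → ℝ}
    (he : Filter.Tendsto e Filter.atTop (nhds 0))
    (h : ∀ n : ℕ, 1 - 1 / (⌊(2 : ℝ) ^ ((n : ℝ) * R)⌋₊ : ℝ) ≤ 3 * e n) : R = 0 := by
  by_contra hne
  have h1 := (tendsto_floor_two_rpow (lt_of_le_of_ne hR (Ne.symm hne))).const_div_atTop 1
  have h2 := le_of_tendsto_of_tendsto' (h1.const_sub 1) (he.const_mul 3) h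
  norm_num at h2

theorem interior_eq_empty_of_isSpoofable {W : Channel 𝒳 𝒴 𝒵} (hW : IsSpoofable W) :
    interior (capacityRegion W) = ∅ := by
  rcases hW with hW | hW
  · have hsub : capacityRegion W ⊆ {0} ×ˢ Set.univ := by
      refine closure_minimal ?_ (isClosed_singleton.prod isClosed_univ)
      rintro R ⟨h1, h2, c, hc⟩
      exact ⟨eq_zero_of_one_sub_le h1 hc fun n => (c n).one_sub_le_of_isASpoofable hW
        (floor_two_rpow_pos h1 n) (floor_two_rpow_pos h2 n), trivial⟩
    refine Set.subset_eq_empty (interior_mono hsub) ?_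
    rw [interior_prod_eq, interior_singleton, Set.empty_prod]
  · have hsub : capacityRegion W ⊆ Set.univ ×ˢ {0} := by
      refine closure_minimal ?_ (isClosed_univ.prod isClosed_singleton)
      rintro R ⟨h1, h2, c, hc⟩
      exact ⟨trivial, eq_zero_of_one_sub_le h2 hc fun n => (c n).one_sub_le_of_isBSpoofable hW
        (floor_two_rpow_pos h1 n) (floor_two_rpow_pos h2 n)⟩
    refine Set.subset_eq_empty (interior_mono hsub) ?_
    rw [interior_prod_eq, interior_singleton, Set.prod_empty]

theorem IsAchievable.of_extend [Nonempty 𝒳] [Nonempty 𝒴] {W : Channel 𝒳 𝒴 𝒵} {R : ℝ × ℝ}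
    (h : IsAchievable W.extend R) : IsAchievable W R := by
  obtain ⟨x₀⟩ := ‹Nonempty 𝒳›
  obtain ⟨y₀⟩ := ‹Nonempty 𝒴›
  obtain ⟨h1, h2, c, hc⟩ := h
  refine ⟨h1, h2, fun n => ⟨fun i t => ((c n).encA i t).1, fun k t => ((c n).encB k t).2,
    (c n).dec⟩, squeeze_zero (fun n => Code.pe_nonneg _ _) (fun n => ?_) hc⟩
  have : Nonempty (Fin n → 𝒳) := ⟨fun _ => x₀⟩
  have : Nonempty (Fin n → 𝒴) := ⟨fun _ => y₀⟩
  refine max_le (le_max_left _ _) (max_le (ciSup_le fun x => ?_) (ciSup_le fun y => ?_))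
  · exact (c n).average_errB_le_pe W.extend fun t => (x t, y₀)
  · exact (c n).average_errA_le_pe W.extend fun t => (x₀, y t)

theorem exists_pos_isAchievable {𝒜 : Type*} [Fintype 𝒜] [Nonempty 𝒜] {W : Channel 𝒜 𝒜 𝒵}
    (hW : ¬ IsSpoofable W) :
    ∃ ε > 0, ∀ R ∈ Set.Ioo (0 : ℝ) ε ×ˢ Set.Ioo (0 : ℝ) ε, IsAchievable W R := by
  obtain ⟨ε, hε, M, C, n₀, h⟩ := exists_code_pe_le hW
  refine ⟨ε, hε, fun R hR => ⟨hR.1.1.le, hR.2.1.le, ?_⟩⟩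
  obtain ⟨a₀⟩ := ‹Nonempty 𝒜›
  have hle : ∀ {r : ℝ}, 0 < r → r < ε → ∀ n : ℕ,
      (⌊(2 : ℝ) ^ ((n : ℝ) * r)⌋₊ : ℝ) ≤ Real.exp (ε * n) := by
    intro r hr hrε n
    refine (Nat.floor_le (by positivity)).trans ?_
    rw [Real.rpow_def_of_pos two_pos]
    refine Real.exp_le_exp.2 ?_
    have h2 : Real.log 2 ≤ 1 := by linarith [Real.log_two_lt_d9]
    calc Real.log 2 * (n * r) ≤ 1 * (n * r) := mul_le_mul_of_nonneg_right h2 (by positivity)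
      _ ≤ ε * n := by
        rw [one_mul, mul_comm ε]
        exact mul_le_mul_of_nonneg_left hrε.le (Nat.cast_nonneg n)
  have hex : ∀ n : ℕ, ∃ c : Code 𝒜 𝒜 𝒵 ⌊(2 : ℝ) ^ ((n : ℝ) * R.1)⌋₊ ⌊(2 : ℝ) ^ ((n : ℝ) * R.2)⌋₊ n,
      n₀ ≤ n → c.pe W ≤ M / ⌊(2 : ℝ) ^ ((n : ℝ) * R.1)⌋₊ + M / ⌊(2 : ℝ) ^ ((n : ℝ) * R.2)⌋₊
        + C * Real.exp (-(ε * n)) := by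
    intro n
    by_cases hn : n₀ ≤ n
    · obtain ⟨c, hc⟩ := h n hn _ _ (floor_two_rpow_pos hR.1.1.le n)
        (floor_two_rpow_pos hR.2.1.le n) (hle hR.1.1 hR.1.2 n) (hle hR.2.1 hR.2.2 n)
      exact ⟨c, fun _ => hc⟩
    · exact ⟨⟨fun _ _ => a₀, fun _ _ => a₀, fun _ => .blameA⟩, fun h => (hn h).elim⟩
  choose c hc using hex
  refine ⟨c, squeeze_zero' (Filter.Eventually.of_forall fun n => Code.pe_nonneg _ _)
    (Filter.eventually_atTop.2 ⟨n₀, fun n hn => hc n hn⟩) ?_⟩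
  have l1 := (tendsto_floor_two_rpow hR.1.1).const_div_atTop M
  have l2 := (tendsto_floor_two_rpow hR.2.1).const_div_atTop M
  have l3 := (tendsto_exp_neg_mul_nat hε).const_mul C
  simpa using (l1.add l2).add l3

theorem nonempty_of_not_isSpoofable {W : Channel 𝒳 𝒴 𝒵} (hW : ¬ IsSpoofable W) :
    Nonempty 𝒳 ∧ Nonempty 𝒴 := by
  classical
  rcases isEmpty_or_nonempty 𝒳 with hX | hX
  · exact (hW (Or.inl ⟨fun x => hX.elim x, fun x => hX.elim x, fun x => hX.elim x⟩)).elim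
  rcases isEmpty_or_nonempty 𝒴 with hY | hY
  · exact (hW (Or.inl ⟨fun _ y => hY.elim y,
      fun x _ => ⟨Pi.single x 1, single_mem_stdSimplex ℝ x⟩, fun _ _ y => hY.elim y⟩)).elim
  exact ⟨hX, hY⟩

end Capacity

end ByzantineMAC

theorem mainTheorem7 {𝒳 𝒴 𝒵 : Type*} [Fintype 𝒳] [Fintype 𝒴] [Fintype 𝒵]
    (W : ByzantineMAC.Channel 𝒳 𝒴 𝒵) :
    interior (ByzantineMAC.capacityRegion W) = ∅ ↔ ByzantineMAC.IsSpoofable W := by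
  open ByzantineMAC in
  refine ⟨fun h => ?_, interior_eq_empty_of_isSpoofable⟩
  by_contra hW
  obtain ⟨hX, hY⟩ := nonempty_of_not_isSpoofable hW
  obtain ⟨ε, hε, hR⟩ := exists_pos_isAchievable (W := W.extend) fun h =>
    hW (h.imp isASpoofable_of_extend isBSpoofable_of_extend)
  have hsub : Set.Ioo (0 : ℝ) ε ×ˢ Set.Ioo (0 : ℝ) ε ⊆ interior (capacityRegion W) :=
    interior_maximal (fun R hmem => subset_closure (hR R hmem).of_extend)
      (isOpen_Ioo.prod isOpen_Ioo)
  rw [h] at hsub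
  exact hsub (a := (ε / 2, ε / 2)) ⟨⟨by positivity, by linarith⟩, ⟨by positivity, by linarith⟩⟩
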